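/- Let $\mathbb{F}_q$ be the finite field with $q$ elements and let $0<\alpha<1$. Call a probability distribution $\mu$ on $\mathbb{F}_q$ \emph{$\alpha$-dense} if $\mu(s+T)\le 1-\alpha$ for every proper additive subgroup $T\subsetneq\mathbb{F}_q$ and every $s\in\mathbb{F}_q$. There are absolute constants $C,K,c>0$ such that the following holds for every finite field $\mathbb{F}_q$, every $0<\alpha<1$, every $\alpha$-dense probability distribution $\mu$ on $\mathbb{F}_q$ and every $n$ with $\alpha n\ge C\log n$ (so, for fixed $\alpha$, for all $n$ sufficiently large in terms of $\alpha$ alone). If $A$ is a random $n\times n$ matrix over $\mathbb{F}_q$ whose entries are independent and identically distributed with distribution $\mu$, then $$\Bigl|\,\mathbb{P}(A\text{ is non-singular})-\prod_{k=1}^{\infty}\bigl(1-q^{-k}\bigr)\Bigr|\le K e^{-c\alpha n}.$$ -/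

import Mathlib

/-- A distribution `μ` on (the additive group of) a finite field `F` is `α`-dense, where
`0 < α < 1`, if every coset `s + T` of every proper additive subgroup `T` of `F` has
probability at most `1 - α`. -/
def IsAlphaDense {F : Type*} [Field F] [MeasurableSpace F]
    (α : ℝ) (μ : MeasureTheory.Measure F) : Prop :=
  0 < α ∧ α < 1 ∧
    ∀ T : AddSubgroup F, T ≠ ⊤ → ∀ s : F, μ.real {x : F | ∃ t ∈ T, x = s + t} ≤ 1 - α

/-!
The rows are exposed one at a time. Given `k` independent rows with span `V`, the next row is
independent of them with probability `1 - p(V)`, where `p` is the product weight on `F ^ n`, so it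
suffices to show that `p(V)` is within `exp (-c α n)` of `q ^ (k - n)`, apart from an event of
probability `exp (-c α n)`; the condition `α n ≥ C log n` absorbs the sum over `k`. For `k < 3n/4`
both quantities are small by Odlyzko's bound (`mass_submodule_le`). For larger `k` there are three
exceptional events.

The first is that a vector with few nonzero coordinates is orthogonal to the rows. For a fixed
support `S`, fewer than `|S|` rows determine a candidate, and each of the other rows is orthogonal
to it with probability bounded away from `1` (`mass_sparse_le`).

The second is that `V` has no sparse normal vectors but is too heavy: `p(V)` is at least twice
`q ^ (k - n)` and not exponentially small. Fourier analysis expresses `p(V)` as an average over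
normal vectors of terms bounded by `exp (-N / 2)`, where the energy `N` measures how far the
Fourier transforms at the coordinates are from having absolute value `1`. The level sets of `N`
at least double when the level is multiplied by `16`, since otherwise a sumset would be a subgroup
on which the average of `N`, which by density is at least `α` times the support size, is too
small (`IsSpread.growth`). Hence `V` is much heavier under a lazy symmetrised weight
(`mass_le_lazyWeight`), and the exchange argument of Kahn, Komlós and Szemerédi, which trades half
of the rows for lazy ones, shows that such spans are exponentially unlikely
(`mass_span_class_le`, `mass_unsaturated_le`).

The third is that `p(V)` is at most twice `q ^ (k - n)`, which is not exponentially small, while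
some normal vector that is not sparse has a large Fourier coefficient. Most coordinates of such a
vector lie in a level set of the energy on `F`, which is a small proportion of `F` by the same
growth property, so that there are few such vectors and few such spaces, and a union bound
suffices (`card_heavyVectors_le`, `mass_heavy_le`).

Outside these events all nontrivial Fourier coefficients on the space of normal vectors are
exponentially small, unless `p(V)` and `q ^ (k - n)` already are, so `p(V)` is close to
`q ^ (k - n)` (`spanDeviation_le`).
-/

namespace RandomMatrix

open Finset Module MeasureTheory ProbabilityTheory
open scoped Classical ComplexConjugate

/-! ### Finite weights -/

/-- A probability vector on a finite type. -/
structure IsWeight {β : Type*} [Fintype β] (p : β → ℝ) : Prop where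
  nonneg : ∀ b, 0 ≤ p b
  sum_eq_one : ∑ b, p b = 1

/-- The product weight on tuples: the law of independent samples from `p`. -/
noncomputable def prodWt {κ β : Type*} [Fintype κ] (p : β → ℝ) (x : κ → β) : ℝ := ∏ i, p (x i)

/-- The mass that the weight `p` gives to the event `Q`. -/
noncomputable def mass {β : Type*} [Fintype β] (p : β → ℝ) (Q : β → Prop) : ℝ :=
  ∑ b, if Q b then p b else 0

section Weights

variable {β : Type*} [Fintype β] {p : β → ℝ}

lemma sum_prodWt_mul {κ : Type*} [Fintype κ] [DecidableEq κ] (p : β → ℝ) (g : κ → β → ℝ) :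
    ∑ x : κ → β, prodWt p x * ∏ i, g i (x i) = ∏ i, ∑ b, p b * g i b := by
  rw [Finset.prod_univ_sum, Fintype.piFinset_univ]
  exact Finset.sum_congr rfl fun x _ => by rw [RandomMatrix.prodWt, ← Finset.prod_mul_distrib]

lemma IsWeight.prodWt {κ : Type*} [Fintype κ] [DecidableEq κ] (hp : IsWeight p) :
    IsWeight (prodWt p : (κ → β) → ℝ) where
  nonneg x := Finset.prod_nonneg fun i _ => hp.nonneg _
  sum_eq_one := by
    have := sum_prodWt_mul (κ := κ) p (fun _ _ => 1)
    simpa [hp.sum_eq_one] using this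

lemma IsWeight.mass_nonneg (hp : IsWeight p) (Q : β → Prop) : 0 ≤ mass p Q :=
  Finset.sum_nonneg fun b _ => by split_ifs <;> simp [hp.nonneg b]

lemma IsWeight.mass_mono (hp : IsWeight p) {Q R : β → Prop} (h : ∀ b, Q b → R b) :
    mass p Q ≤ mass p R :=
  Finset.sum_le_sum fun b _ => by
    have := hp.nonneg b
    by_cases hQ : Q b
    · simp [hQ, h b hQ]
    · simp only [hQ, if_false]; split_ifs <;> simp [this]

lemma IsWeight.mass_true (hp : IsWeight p) : mass p (fun _ => True) = 1 := by
  simp [mass, hp.sum_eq_one]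

lemma IsWeight.mass_le_one (hp : IsWeight p) (Q : β → Prop) : mass p Q ≤ 1 :=
  (hp.mass_mono fun _ _ => trivial).trans_eq hp.mass_true

lemma IsWeight.mass_not (hp : IsWeight p) (Q : β → Prop) :
    mass p (fun b => ¬ Q b) = 1 - mass p Q := by
  rw [eq_sub_iff_add_eq, ← hp.sum_eq_one, mass, mass, ← Finset.sum_add_distrib]
  exact Finset.sum_congr rfl fun b _ => by by_cases h : Q b <;> simp [h]

lemma IsWeight.mass_exists_le (hp : IsWeight p) {ι : Type*} (s : Finset ι) (Q : β → Prop)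
    (R : ι → β → Prop) (h : ∀ b, Q b → ∃ i ∈ s, R i b) : mass p Q ≤ ∑ i ∈ s, mass p (R i) := by
  unfold mass
  rw [Finset.sum_comm]
  refine Finset.sum_le_sum fun b _ => ?_
  have hb := hp.nonneg b
  have hnn : ∀ i ∈ s, 0 ≤ if R i b then p b else 0 := fun i _ => by split_ifs <;> simp [hb]
  by_cases hQ : Q b
  · obtain ⟨i, hi, hR⟩ := h b hQ
    rw [if_pos hQ]
    calc p b = if R i b then p b else 0 := by rw [if_pos hR]
      _ ≤ _ := Finset.single_le_sum hnn hi
  · rw [if_neg hQ]; exact Finset.sum_nonneg hnn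

lemma mass_eq_sum_mul (p : β → ℝ) (Q : β → Prop) :
    mass p Q = ∑ b, p b * (if Q b then 1 else 0) := by simp [mass]

lemma mass_prodWt_forall {κ : Type*} [Fintype κ] [DecidableEq κ] (p : β → ℝ)
    (Q : κ → β → Prop) :
    mass (prodWt p) (fun x : κ → β => ∀ i, Q i (x i)) = ∏ i, mass p (Q i) := by
  have := sum_prodWt_mul (κ := κ) p (fun i b => if Q i b then 1 else 0)
  simp only [← mass_eq_sum_mul] at this
  rw [← this, mass_eq_sum_mul]
  refine Finset.sum_congr rfl fun x _ => ?_
  congr 1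
  by_cases h : ∀ i, Q i (x i)
  · simp [h]
  · rw [if_neg h]; push Not at h; obtain ⟨i, hi⟩ := h
    exact (Finset.prod_eq_zero (Finset.mem_univ i) (by simp [hi])).symm

/-- Splitting the coordinates of a tuple into those in `I` and the others: once the coordinates
in `I` are fixed, the others are independent samples. -/
lemma sum_prodWt_split {κ : Type*} [Fintype κ] [DecidableEq κ] (p : β → ℝ) (I : Finset κ)
    (h : (I → β) → ℝ) (R : (I → β) → κ → β → Prop) :
    ∑ x : κ → β, prodWt p x *
        (if ∀ i, i ∉ I → R (fun j : I => x j) i (x i) then h (fun j : I => x j) else 0) =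
      ∑ y : I → β, prodWt p y * (h y * ∏ i : {i // i ∉ I}, mass p (R y i)) := by
  rw [← (Equiv.piEquivPiSubtypeProd (fun i => i ∈ I) (fun _ => β)).symm.sum_comp,
    Fintype.sum_prod_type]
  refine Finset.sum_congr rfl fun y _ => ?_
  rw [← mass_prodWt_forall, mass_eq_sum_mul, ← mul_assoc, Finset.mul_sum]
  refine Finset.sum_congr rfl fun z _ => ?_
  set x := (Equiv.piEquivPiSubtypeProd (fun i => i ∈ I) (fun _ => β)).symm (y, z) with hx
  have h1 : (fun j : I => x j) = y := by
    funext j; simp [hx, Equiv.piEquivPiSubtypeProd]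
  have h2 : ∀ j : {i // i ∉ I}, x j = z j := by
    intro j; simp [hx, Equiv.piEquivPiSubtypeProd, j.2]
  have h3 : prodWt p x = prodWt p y * prodWt p z := by
    unfold prodWt
    rw [← Fintype.prod_subtype_mul_prod_subtype (fun i => i ∈ I)]
    congr 1
    · exact Finset.prod_congr (by ext; simp) fun j _ => by rw [← h1]
    · exact Finset.prod_congr rfl fun j _ => by rw [← h2]
  rw [h3, h1]
  have h4 : (∀ i, i ∉ I → R y i (x i)) ↔ ∀ i : {i // i ∉ I}, R y i (z i) :=
    ⟨fun H i => h2 i ▸ H i i.2, fun H i hi => (h2 ⟨i, hi⟩).symm ▸ H ⟨i, hi⟩⟩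
  by_cases h5 : ∀ i : {i // i ∉ I}, R y i (z i)
  · rw [if_pos (h4.2 h5), if_pos h5]; ring
  · rw [if_neg (fun H => h5 (h4.1 H)), if_neg h5]; ring

lemma card_notMem {κ : Type*} [Fintype κ] [DecidableEq κ] (I : Finset κ) :
    Fintype.card {i // i ∉ I} = Fintype.card κ - I.card := by
  rw [Fintype.card_subtype_compl]; simp

end Weights

/-! ### Growth of level sets and a comparison of exponential sums -/

section Growth

variable {G : Type*} [AddCommGroup G] [Fintype G]

/-- The size of the level set `{g | N g ≤ u}`. -/
noncomputable def levelCard (N : G → ℝ) (u : ℝ) : ℝ := ((univ.filter fun g => N g ≤ u).card : ℝ)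

/-- The properties of an even, quadratically subadditive function whose average over each
nontrivial subgroup is at least `B`. -/
structure IsSpread (N : G → ℝ) (B : ℝ) : Prop where
  zero : N 0 = 0
  neg : ∀ g, N (-g) = N g
  add_le : ∀ g h, N (g + h) ≤ 2 * (N g + N h)
  subgroup : ∀ H : AddSubgroup G, H ≠ ⊥ → B * Fintype.card H ≤ ∑ h : H, N h

variable {N : G → ℝ} {B : ℝ}

lemma IsSpread.nonneg (h : IsSpread N B) (g : G) : 0 ≤ N g := by
  have := h.add_le g (-g)
  rw [add_neg_cancel, h.zero, h.neg] at this
  linarith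

/-- A level set doubles when the level grows by a factor `16`. If every sum of three elements
of `T = {N ≤ u}` is a sum of two, then `T + T` is a subgroup on which `N` is small, so it is
trivial. Otherwise some translate `x + T` with `x ∈ T + T + T` is disjoint from `T`. -/
lemma IsSpread.growth (hN : IsSpread N B) {u : ℝ} (hu : 0 ≤ u) (hB : 4 * u < B) :
    2 * (levelCard N u - 1) ≤ levelCard N (16 * u) - 1 := by
  set T := univ.filter fun g => N g ≤ u with hT
  have memT : ∀ g, g ∈ T ↔ N g ≤ u := fun g => by simp [hT]
  have h0T : (0 : G) ∈ T := by rw [memT, hN.zero]; exact hu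
  have hsub : T ⊆ univ.filter fun g => N g ≤ 16 * u := fun g hg => by
    rw [memT] at hg; simp only [mem_filter, mem_univ, true_and]; linarith
  by_cases h3 : ∀ a ∈ T, ∀ b ∈ T, ∀ c ∈ T, ∃ d ∈ T, ∃ e ∈ T, a + b + c = d + e
  · let H : AddSubgroup G :=
      { carrier := {x | ∃ d ∈ T, ∃ e ∈ T, x = d + e}
        zero_mem' := ⟨0, h0T, 0, h0T, by simp⟩
        add_mem' := by
          rintro x y ⟨a, ha, b, hb, rfl⟩ ⟨c, hc, d, hd, rfl⟩
          obtain ⟨a', ha', b', hb', h⟩ := h3 a ha b hb c hc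
          obtain ⟨a'', ha'', b'', hb'', h'⟩ := h3 a' ha' b' hb' d hd
          exact ⟨a'', ha'', b'', hb'', by rw [← h', ← h]; abel⟩
        neg_mem' := by
          rintro x ⟨a, ha, b, hb, rfl⟩
          refine ⟨-a, ?_, -b, ?_, by abel⟩
          · rw [memT, hN.neg]; exact (memT a).1 ha
          · rw [memT, hN.neg]; exact (memT b).1 hb }
    have hbot : H = ⊥ := by
      by_contra hne
      have h1 := hN.subgroup H hne
      have h2 : ∑ h : H, N h ≤ ∑ _h : H, 4 * u := Finset.sum_le_sum fun h _ => by
        obtain ⟨d, hd, e, he, hde⟩ := h.2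
        rw [hde]
        have := hN.add_le d e
        rw [memT] at hd he
        linarith
      have h4 : (0 : ℝ) < Fintype.card H := by exact_mod_cast Fintype.card_pos
      rw [Finset.sum_const, Finset.card_univ, nsmul_eq_mul] at h2
      nlinarith
    have hT1 : T = {0} := by
      refine Finset.eq_singleton_iff_unique_mem.2 ⟨h0T, fun x hx => ?_⟩
      have : x ∈ H := ⟨x, hx, 0, h0T, by simp⟩
      rwa [hbot, AddSubgroup.mem_bot] at this
    have : T.card ≤ (univ.filter fun g => N g ≤ 16 * u).card := Finset.card_le_card hsub
    have h5 : levelCard N u = 1 := by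
      unfold levelCard; rw [← hT, hT1]; simp
    rw [hT1, Finset.card_singleton] at this
    have h6 : (1 : ℝ) ≤ levelCard N (16 * u) := by unfold levelCard; exact_mod_cast this
    rw [h5]; linarith
  · push Not at h3
    obtain ⟨a, ha, b, hb, c, hc, hne⟩ := h3
    have hdisj : Disjoint T (T.image fun t => a + b + c + t) := by
      rw [Finset.disjoint_left]
      intro x hx hx'
      obtain ⟨t, ht, rfl⟩ := Finset.mem_image.1 hx'
      refine hne _ hx (-t) ?_ (by abel)
      rw [memT, hN.neg]; exact (memT t).1 ht
    have hun : T ∪ (T.image fun t => a + b + c + t) ⊆ univ.filter fun g => N g ≤ 16 * u := by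
      refine Finset.union_subset hsub fun x hx => ?_
      obtain ⟨t, ht, rfl⟩ := Finset.mem_image.1 hx
      rw [memT] at ha hb hc ht
      simp only [mem_filter, mem_univ, true_and]
      have h1 := hN.add_le (a + b) (c + t)
      have h2 := hN.add_le a b
      have h3 := hN.add_le c t
      rw [show a + b + c + t = a + b + (c + t) by abel]
      linarith
    have hcard := Finset.card_le_card hun
    rw [Finset.card_union_of_disjoint hdisj,
      Finset.card_image_of_injective _ (add_right_injective _)] at hcard
    have : (T.card : ℝ) + T.card ≤ levelCard N (16 * u) := by
      unfold levelCard; exact_mod_cast hcard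
    have h7 : levelCard N u = T.card := rfl
    rw [h7]; linarith

lemma IsSpread.growth_iterate (hN : IsSpread N B) {u : ℝ} (hu : 0 ≤ u) (j : ℕ)
    (hB : 16 ^ j * u < B) :
    2 ^ j * (levelCard N u - 1) ≤ levelCard N (16 ^ j * u) - 1 := by
  induction j with
  | zero => simp
  | succ j ih =>
    have h0 : 0 ≤ (16 : ℝ) ^ j * u := by positivity
    have h1 : (16 : ℝ) ^ (j + 1) * u = 16 * (16 ^ j * u) := by ring
    rw [h1] at hB ⊢
    have h2 := hN.growth h0 (by linarith)
    have h3 := ih (by linarith)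
    rw [pow_succ]
    linarith

/-- Level sets below the spread are trivial or occupy a small proportion of the group. -/
lemma IsSpread.levelCard_le (hN : IsSpread N B) {u : ℝ} (hu : 0 ≤ u) (j : ℕ)
    (hB : 16 ^ j * u < B) :
    levelCard N u = 1 ∨ 2 ^ j * levelCard N u ≤ 2 * Fintype.card G := by
  have h1 := hN.growth_iterate hu j hB
  have h2 : levelCard N (16 ^ j * u) ≤ Fintype.card G := by
    unfold levelCard; exact_mod_cast Finset.card_le_univ _
  have h0 : (0 : G) ∈ univ.filter fun g => N g ≤ u := by simp [hN.zero, hu]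
  have h3 := Finset.card_pos.2 ⟨_, h0⟩
  rcases Nat.lt_or_ge 1 (univ.filter fun g => N g ≤ u).card with h | h
  · right
    have h4 : (2 : ℝ) ≤ levelCard N u := by unfold levelCard; exact_mod_cast h
    have h5 : (0 : ℝ) < 2 ^ j := by positivity
    nlinarith
  · left
    unfold levelCard
    exact_mod_cast le_antisymm h h3

lemma intervalIntegrable_ite_le (a : ℝ) :
    IntervalIntegrable (fun y : ℝ => if y ≤ a then (1 : ℝ) else 0) MeasureTheory.volume 0 1 := by
  have : Antitone fun y : ℝ => if y ≤ a then (1 : ℝ) else 0 := by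
    intro x y hxy
    dsimp only
    split_ifs with h1 h2 <;> linarith
  exact this.intervalIntegrable

lemma integral_ite_le {a : ℝ} (h0 : 0 ≤ a) (h1 : a ≤ 1) :
    ∫ y in (0 : ℝ)..1, (if y ≤ a then (1 : ℝ) else 0) = a := by
  have e : (fun y : ℝ => if y ≤ a then (1 : ℝ) else 0) = (Set.Iic a).indicator 1 := by
    funext y; simp [Set.indicator]
  rw [e, intervalIntegral.integral_of_le zero_le_one,
    MeasureTheory.integral_indicator_one measurableSet_Iic, MeasureTheory.measureReal_def,
    MeasureTheory.Measure.restrict_apply measurableSet_Iic, Set.inter_comm, Set.Ioc_inter_Iic,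
    inf_eq_right.2 h1]
  simp [h0]

/-- If the level sets of `N` below `u₀` grow by a factor `M` when the level is multiplied by
`R`, then so does the exponential sum restricted to `{N ≤ u₀}`: both sums are integrals of the
sizes of level sets. -/
lemma sum_exp_le_of_growth [DecidableEq G] {M R u₀ : ℝ} (hR : 0 < R) (h0 : N 0 = 0)
    (hN : ∀ g, 0 ≤ N g)
    (hg : ∀ u, 0 ≤ u → u ≤ u₀ → M * (levelCard N u - 1) ≤ levelCard N (R * u) - 1)
    (hu₀ : 0 ≤ u₀) :
    M * ∑ g ∈ univ.filter (fun g => g ≠ 0 ∧ N g ≤ u₀), Real.exp (-(N g / 2)) ≤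
      ∑ g ∈ univ.filter (fun g : G => g ≠ 0), Real.exp (-(N g / (2 * R))) := by
  have key : ∀ (s : Finset G) (f : G → ℝ), (∀ g, 0 ≤ f g) → ∑ g ∈ s, Real.exp (-(f g)) =
      ∫ y in (0 : ℝ)..1, ∑ g ∈ s, if y ≤ Real.exp (-(f g)) then (1 : ℝ) else 0 := by
    intro s f hf
    rw [intervalIntegral.integral_finsetSum fun g _ => intervalIntegrable_ite_le _]
    refine Finset.sum_congr rfl fun g _ => ?_
    rw [integral_ite_le (Real.exp_pos _).le (Real.exp_le_one_iff.2 (by linarith [hf g]))]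
  have hint : ∀ (s : Finset G) (f : G → ℝ), IntervalIntegrable
      (fun y : ℝ => ∑ g ∈ s, if y ≤ Real.exp (-(f g)) then (1 : ℝ) else 0)
      MeasureTheory.volume 0 1 := by
    intro s f
    have := IntervalIntegrable.sum s (fun g _ => intervalIntegrable_ite_le (Real.exp (-(f g))))
    rwa [Finset.sum_fn] at this
  have hlev : ∀ u, 0 ≤ u →
      levelCard N u - 1 = ((univ.filter fun g => g ≠ 0 ∧ N g ≤ u).card : ℝ) := by
    intro u hu
    have : (univ.filter fun g => N g ≤ u) = insert 0 (univ.filter fun g => g ≠ 0 ∧ N g ≤ u) := by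
      ext g
      by_cases h : g = 0
      · simp [h, h0, hu]
      · simp [h]
    rw [levelCard, this, Finset.card_insert_of_notMem (by simp)]
    push_cast; ring
  rw [key _ _ (fun g => by have := hN g; positivity),
    key _ _ (fun g => by have := hN g; positivity), ← intervalIntegral.integral_const_mul]
  refine intervalIntegral.integral_mono_on_of_le_Ioo zero_le_one ((hint _ _).const_mul M)
    (hint _ _) fun y hy => ?_
  set v := -2 * Real.log y with hv
  have hv0 : 0 ≤ v := by
    have := Real.log_nonpos hy.1.le hy.2.le
    linarith
  have hiff : ∀ t : ℝ, y ≤ Real.exp (-t) ↔ t ≤ v / 2 := by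
    intro t
    rw [← Real.log_le_iff_le_exp hy.1, hv]
    constructor <;> intro h <;> linarith
  simp only [hiff, Finset.sum_boole, Finset.filter_filter]
  have h1 := hg (min v u₀) (le_min hv0 hu₀) (min_le_right _ _)
  rw [hlev _ (le_min hv0 hu₀), hlev _ (by have := le_min hv0 hu₀; positivity)] at h1
  have h2 : (univ.filter fun g => (g ≠ 0 ∧ N g ≤ u₀) ∧ N g / 2 ≤ v / 2) =
      univ.filter fun g => g ≠ 0 ∧ N g ≤ min v u₀ := by
    ext g
    simp only [mem_filter, mem_univ, true_and, le_min_iff]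
    constructor
    · rintro ⟨⟨a, b⟩, c⟩; exact ⟨a, by linarith, b⟩
    · rintro ⟨a, b, c⟩; exact ⟨⟨a, c⟩, by linarith⟩
  rw [h2]
  refine h1.trans ?_
  have h3 : (univ.filter fun g => g ≠ 0 ∧ N g ≤ R * min v u₀) ⊆
      univ.filter fun g => g ≠ 0 ∧ N g / (2 * R) ≤ v / 2 := by
    intro g
    simp only [mem_filter, mem_univ, true_and]
    rintro ⟨a, b⟩
    refine ⟨a, ?_⟩
    rw [div_le_iff₀ (by positivity)]
    have := mul_le_mul_of_nonneg_left (min_le_left v u₀) hR.le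
    linarith
  exact_mod_cast Finset.card_le_card h3

end Growth

/-! ### Characters of the field and the energy of a weight -/

section Fourier

variable {F : Type*} [Field F] [Fintype F]

/-- Weights on `F` for which every coset of every proper additive subgroup has mass at most
`1 - α`. -/
def IsDenseWeight (α : ℝ) (w : F → ℝ) : Prop :=
  ∀ T : AddSubgroup F, T ≠ ⊤ → ∀ s : F, mass w (fun x => x - s ∈ T) ≤ 1 - α

/-- The Fourier transform of `w` with respect to the additive character `ψ`. -/
noncomputable def charFn (ψ : AddChar F ℂ) (w : F → ℝ) (x : F) : ℂ := ∑ a, (w a : ℂ) * ψ (x * a)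

/-- The energy `1 - |ŵ(x)|²`, written as the average of `1 - Re ψ(x(a - b))` over independent
samples `a`, `b`. -/
noncomputable def energy (ψ : AddChar F ℂ) (w : F → ℝ) (x : F) : ℝ :=
  ∑ a, ∑ b, w a * w b * (1 - (ψ (x * (a - b))).re)

variable {ψ : AddChar F ℂ} {w : F → ℝ} {α : ℝ}

lemma coe_norm_charFn_sq (ψ : AddChar F ℂ) (w : F → ℝ) (x : F) :
    ((‖charFn ψ w x‖ ^ 2 : ℝ) : ℂ) = ∑ a, ∑ b, (w a : ℂ) * w b * ψ (x * (a - b)) := by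
  rw [← Complex.normSq_eq_norm_sq, Complex.normSq_eq_conj_mul_self, mul_comm]
  unfold charFn
  rw [map_sum, Finset.sum_mul_sum]
  refine Finset.sum_congr rfl fun a _ => Finset.sum_congr rfl fun b _ => ?_
  rw [map_mul (starRingEnd ℂ), Complex.conj_ofReal, ← AddChar.map_neg_eq_conj, mul_sub,
    sub_eq_add_neg, AddChar.map_add_eq_mul]
  ring

lemma norm_charFn_sq (hw : IsWeight w) (x : F) :
    ‖charFn ψ w x‖ ^ 2 = 1 - energy ψ w x := by
  have h2 := congrArg Complex.re (coe_norm_charFn_sq ψ w x)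
  rw [Complex.ofReal_re] at h2
  rw [h2, energy]
  simp only [Complex.re_sum, mul_sub, Finset.sum_sub_distrib, mul_one, ← Finset.mul_sum,
    hw.sum_eq_one]
  simp only [sub_sub_cancel]
  refine Finset.sum_congr rfl fun a _ => Finset.sum_congr rfl fun b _ => ?_
  rw [← Complex.ofReal_mul, Complex.re_ofReal_mul]

lemma one_sub_re_nonneg (ψ : AddChar F ℂ) (x : F) : 0 ≤ 1 - (ψ x).re := by
  have h1 := Complex.re_le_norm (ψ x)
  rw [AddChar.norm_apply] at h1
  linarith

lemma one_sub_re_add_le (ψ : AddChar F ℂ) (x y : F) :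
    1 - (ψ (x + y)).re ≤ 2 * ((1 - (ψ x).re) + (1 - (ψ y).re)) := by
  have hx : (ψ x).re ^ 2 + (ψ x).im ^ 2 = 1 := by
    have := Complex.sq_norm (ψ x)
    rw [AddChar.norm_apply, Complex.normSq_apply] at this
    linarith
  have hy : (ψ y).re ^ 2 + (ψ y).im ^ 2 = 1 := by
    have := Complex.sq_norm (ψ y)
    rw [AddChar.norm_apply, Complex.normSq_apply] at this
    linarith
  rw [AddChar.map_add_eq_mul, Complex.mul_re]
  nlinarith [sq_nonneg (2 - (ψ x).re - (ψ y).re), sq_nonneg ((ψ x).im - (ψ y).im),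
    sq_nonneg ((ψ x).re + (ψ y).re - 2), sq_nonneg ((ψ x).im + (ψ y).im)]

lemma energy_nonneg (hw : IsWeight w) (x : F) : 0 ≤ energy ψ w x :=
  Finset.sum_nonneg fun a _ => Finset.sum_nonneg fun b _ =>
    mul_nonneg (mul_nonneg (hw.nonneg a) (hw.nonneg b)) (one_sub_re_nonneg ψ _)

lemma energy_le_one (hw : IsWeight w) (x : F) : energy ψ w x ≤ 1 := by
  have := norm_charFn_sq (ψ := ψ) hw x
  have := sq_nonneg ‖charFn ψ w x‖
  linarith

lemma energy_zero (ψ : AddChar F ℂ) (w : F → ℝ) : energy ψ w 0 = 0 := by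
  simp [energy]

lemma energy_neg (ψ : AddChar F ℂ) (w : F → ℝ) (x : F) : energy ψ w (-x) = energy ψ w x := by
  unfold energy
  refine Finset.sum_congr rfl fun a _ => Finset.sum_congr rfl fun b _ => ?_
  rw [neg_mul, AddChar.map_neg_eq_conj, Complex.conj_re]

lemma energy_add_le (hw : IsWeight w) (x y : F) :
    energy ψ w (x + y) ≤ 2 * (energy ψ w x + energy ψ w y) := by
  unfold energy
  rw [← Finset.sum_add_distrib, Finset.mul_sum]
  refine Finset.sum_le_sum fun a _ => ?_
  rw [← Finset.sum_add_distrib, Finset.mul_sum]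
  refine Finset.sum_le_sum fun b _ => ?_
  have h1 := one_sub_re_add_le ψ (x * (a - b)) (y * (a - b))
  rw [← add_mul] at h1
  have h2 := mul_le_mul_of_nonneg_left h1 (mul_nonneg (hw.nonneg a) (hw.nonneg b))
  linarith

/-- The average of the energy over the image of a nontrivial homomorphism is at least `α`:
averaging the characters gives the probability that the difference of two samples avoids a
proper additive subgroup. -/
lemma le_sum_energy (hψ : ψ ≠ 1) (hw : IsWeight w) (hα : IsDenseWeight α w)
    {H : Type*} [AddCommGroup H] [Fintype H] (φ : H →+ F) (hφ : φ ≠ 0) :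
    α * Fintype.card H ≤ ∑ h, energy ψ w (φ h) := by
  let T : AddSubgroup F :=
    { carrier := {z | ∀ h, ψ (φ h * z) = 1}
      zero_mem' := fun h => by simp
      add_mem' := fun {x y} hx hy h => by
        rw [mul_add, AddChar.map_add_eq_mul, hx h, hy h, one_mul]
      neg_mem' := fun {x} hx h => by
        rw [mul_neg, AddChar.map_neg_eq_inv, hx h, inv_one] }
  have hT : T ≠ ⊤ := by
    intro hT
    obtain ⟨h, hh⟩ := DFunLike.ne_iff.1 hφ
    rw [AddMonoidHom.zero_apply] at hh
    refine hψ (DFunLike.ext _ _ fun z => ?_)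
    have h1 : (φ h)⁻¹ * z ∈ T := by rw [hT]; trivial
    have h2 := h1 h
    rwa [mul_inv_cancel_left₀ hh] at h2
  have hsum : ∀ z, ∑ h, (1 - (ψ (φ h * z)).re) =
      (Fintype.card H : ℝ) * (if z ∈ T then 0 else 1) := by
    intro z
    let χ : AddChar H ℂ :=
      { toFun := fun h => ψ (φ h * z)
        map_zero_eq_one' := by simp
        map_add_eq_mul' := fun x y => by rw [map_add, add_mul, AddChar.map_add_eq_mul] }
    have h1 : ∑ h, (ψ (φ h * z)).re = if z ∈ T then (Fintype.card H : ℝ) else 0 := by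
      have h2 := AddChar.sum_eq_ite χ
      have h3 : χ = 0 ↔ z ∈ T :=
        ⟨fun h x => congrArg (fun c : AddChar H ℂ => c x) h, fun h => DFunLike.ext _ _ fun x => h x⟩
      have h4 := congrArg Complex.re h2
      rw [Complex.re_sum] at h4
      refine (h4.trans ?_)
      by_cases hz : z ∈ T
      · rw [if_pos (h3.2 hz), if_pos hz]; simp
      · rw [if_neg (fun h => hz (h3.1 h)), if_neg hz]; simp
    rw [Finset.sum_sub_distrib, h1]
    split_ifs <;> simp
  have hswap : ∑ h, energy ψ w (φ h) =
      Fintype.card H * ∑ b, w b * (1 - mass w (fun a => a - b ∈ T)) := by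
    calc ∑ h, energy ψ w (φ h)
        = ∑ a, ∑ b, w a * w b * ∑ h, (1 - (ψ (φ h * (a - b))).re) := by
          unfold energy
          rw [Finset.sum_comm]
          refine Finset.sum_congr rfl fun a _ => ?_
          rw [Finset.sum_comm]
          exact Finset.sum_congr rfl fun b _ => by rw [Finset.mul_sum]
      _ = ∑ b, ∑ a, w a * w b * (Fintype.card H * (if a - b ∈ T then 0 else 1)) := by
          rw [Finset.sum_comm]
          simp only [hsum]
      _ = _ := by
          rw [Finset.mul_sum]
          refine Finset.sum_congr rfl fun b _ => ?_
          rw [← hw.mass_not, mass, Finset.mul_sum, Finset.mul_sum]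
          refine Finset.sum_congr rfl fun a _ => ?_
          by_cases h : a - b ∈ T <;> simp [h]; ring
  rw [hswap, mul_comm]
  refine mul_le_mul_of_nonneg_left ?_ (Nat.cast_nonneg _)
  calc α = ∑ b, w b * α := by rw [← Finset.sum_mul, hw.sum_eq_one, one_mul]
    _ ≤ _ := Finset.sum_le_sum fun b _ =>
      mul_le_mul_of_nonneg_left (by have := hα T hT b; linarith) (hw.nonneg b)

/-- The total energy of a family of homomorphisms into `F` such that no nonzero element is
killed by all but fewer than `s` of them. -/
lemma isSpread_sum_energy (hψ : ψ ≠ 1) (hw : IsWeight w) (hα : IsDenseWeight α w) (hα0 : 0 ≤ α)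
    {G ι : Type*} [AddCommGroup G] [Fintype G] [Fintype ι] (φ : ι → G →+ F) {s : ℝ}
    (hs : ∀ g, g ≠ 0 → s ≤ (univ.filter fun i => φ i g ≠ 0).card) :
    IsSpread (fun g => ∑ i, energy ψ w (φ i g)) (α * s) where
  zero := by simp [energy_zero]
  neg g := by simp [energy_neg]
  add_le g h := by
    rw [← Finset.sum_add_distrib, Finset.mul_sum]
    exact Finset.sum_le_sum fun i _ => by rw [map_add]; exact energy_add_le hw _ _
  subgroup H hH := by
    obtain ⟨g, hgH, hg⟩ := (AddSubgroup.ne_bot_iff_exists_ne_zero).1 hH |>.elim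
      fun a ha => (⟨a.1, a.2, fun h => ha (Subtype.ext h)⟩ : ∃ g, g ∈ H ∧ g ≠ 0)
    rw [Finset.sum_comm]
    calc α * s * Fintype.card H
        ≤ α * (univ.filter fun i => φ i g ≠ 0).card * Fintype.card H := by
          gcongr; exact hs g hg
      _ = ∑ i ∈ univ.filter (fun i => φ i g ≠ 0), α * Fintype.card H := by
          rw [Finset.sum_const, nsmul_eq_mul]; ring
      _ ≤ ∑ i ∈ univ.filter (fun i => φ i g ≠ 0), ∑ h : H, energy ψ w (φ i h) := by
          refine Finset.sum_le_sum fun i hi => ?_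
          have hi' := (Finset.mem_filter.1 hi).2
          exact le_sum_energy hψ hw hα ((φ i).comp H.subtype)
            (fun h => hi' (DFunLike.congr_fun h (⟨g, hgH⟩ : H)))
      _ ≤ _ := Finset.sum_le_sum_of_subset_of_nonneg (Finset.subset_univ _) fun i _ _ =>
          Finset.sum_nonneg fun h _ => energy_nonneg hw _

lemma addChar_map_sum {A ι : Type*} [AddCommMonoid A] (ψ : AddChar A ℂ) (s : Finset ι)
    (f : ι → A) :
    ψ (∑ i ∈ s, f i) = ∏ i ∈ s, ψ (f i) := by
  induction s using Finset.induction_on with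
  | empty => simp
  | insert a s ha ih =>
    rw [Finset.sum_insert ha, Finset.prod_insert ha, AddChar.map_add_eq_mul, ih]

/-- Fourier inversion: the mass of the annihilator of a space of linear forms. -/
lemma mass_annihilator {ι G : Type*} [Fintype ι] [DecidableEq ι] [AddCommGroup G] [Module F G]
    [Fintype G] (hψ : ψ ≠ 1) (w : F → ℝ) (φ : G →ₗ[F] (ι → F)) :
    (mass (prodWt w) (fun v : ι → F => ∀ g, φ g ⬝ᵥ v = 0) : ℂ) =
      (Fintype.card G : ℂ)⁻¹ * ∑ g, ∏ i, charFn ψ w (φ g i) := by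
  have h1 : ∀ g : G, ∏ i, charFn ψ w (φ g i) = ∑ v : ι → F, (prodWt w v : ℂ) * ψ (φ g ⬝ᵥ v) := by
    intro g
    unfold charFn
    rw [Finset.prod_univ_sum, Fintype.piFinset_univ]
    refine Finset.sum_congr rfl fun v _ => ?_
    rw [Finset.prod_mul_distrib, prodWt, dotProduct, addChar_map_sum]
    push_cast; rfl
  have h2 : ∀ v : ι → F, ∑ g, ψ (φ g ⬝ᵥ v) =
      if ∀ g, φ g ⬝ᵥ v = 0 then (Fintype.card G : ℂ) else 0 := by
    intro v
    let χ : AddChar G ℂ :=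
      { toFun := fun g => ψ (φ g ⬝ᵥ v)
        map_zero_eq_one' := by simp
        map_add_eq_mul' := fun x y => by rw [map_add, add_dotProduct, AddChar.map_add_eq_mul] }
    have h3 : χ = 0 ↔ ∀ g, φ g ⬝ᵥ v = 0 := by
      constructor
      · intro h g
        by_contra hg
        refine hψ (DFunLike.ext _ _ fun z => ?_)
        have h4 := congrArg (fun c : AddChar G ℂ => c ((z / (φ g ⬝ᵥ v)) • g)) h
        simpa [χ, div_mul_cancel₀ _ hg] using h4
      · intro h
        refine DFunLike.ext _ _ fun g => ?_
        change ψ (φ g ⬝ᵥ v) = 1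
        rw [h g, AddChar.map_zero_eq_one]
    refine (AddChar.sum_eq_ite χ).trans ?_
    by_cases h : ∀ g, φ g ⬝ᵥ v = 0
    · rw [if_pos (h3.2 h), if_pos h]
    · rw [if_neg (fun H => h (h3.1 H)), if_neg h]
  have hG : (Fintype.card G : ℂ) ≠ 0 := Nat.cast_ne_zero.2 Fintype.card_ne_zero
  rw [eq_inv_mul_iff_mul_eq₀ hG]
  simp only [h1]
  rw [Finset.sum_comm, mass]
  push_cast
  rw [Finset.mul_sum]
  refine Finset.sum_congr rfl fun v _ => ?_
  rw [← Finset.mul_sum, h2]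
  split_ifs <;> simp [mul_comm]

/-- The size of the Fourier transform of the product weight decays with the total energy. -/
lemma prod_norm_charFn_le {ι : Type*} [Fintype ι] (hw : IsWeight w) (x : ι → F) :
    ∏ i, ‖charFn ψ w (x i)‖ ≤ Real.exp (-((∑ i, energy ψ w (x i)) / 2)) := by
  rw [Finset.sum_div, ← Finset.sum_neg_distrib, Real.exp_sum]
  refine Finset.prod_le_prod (fun i _ => norm_nonneg _) fun i _ => ?_
  refine le_of_sq_le_sq ?_ (Real.exp_pos _).le
  rw [norm_charFn_sq hw, ← Real.exp_nat_mul]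
  have := Real.add_one_le_exp (-energy ψ w (x i))
  rw [show ((2 : ℕ) : ℝ) * -(energy ψ w (x i) / 2) = -energy ψ w (x i) by push_cast; ring]
  linarith

end Fourier

/-! ### Orthogonal spaces, Odlyzko's bound and lazy weights -/

section Perp

variable {F : Type*} [Field F] {ι : Type*} [Fintype ι]

/-- The space of vectors orthogonal to `V` for the standard bilinear form. -/
def perp (V : Submodule F (ι → F)) : Submodule F (ι → F) where
  carrier := {ξ | ∀ v ∈ V, ξ ⬝ᵥ v = 0}
  zero_mem' := fun v _ => by simp
  add_mem' := fun {x y} hx hy v hv => by rw [add_dotProduct, hx v hv, hy v hv, add_zero]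
  smul_mem' := fun c x hx v hv => by rw [smul_dotProduct, hx v hv, smul_zero]

lemma mem_perp_span {κ : Type*} {X : κ → ι → F} {ξ : ι → F} :
    ξ ∈ perp (Submodule.span F (Set.range X)) ↔ ∀ i, ξ ⬝ᵥ X i = 0 := by
  refine ⟨fun h i => h _ (Submodule.subset_span ⟨i, rfl⟩), fun h v hv => ?_⟩
  induction hv using Submodule.span_induction with
  | mem x hx => obtain ⟨i, rfl⟩ := hx; exact h i
  | zero => simp
  | add x y _ _ hx hy => rw [dotProduct_add, hx, hy, add_zero]
  | smul c x _ hx => rw [dotProduct_smul, hx, smul_zero]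

variable [DecidableEq ι]

lemma nondegenerate_dotProductBilin :
    (dotProductBilin F F : LinearMap.BilinForm F (ι → F)).Nondegenerate :=
  ⟨fun x hx => funext fun i => by simpa using hx (Pi.single i 1),
    fun x hx => funext fun i => by simpa using hx (Pi.single i 1)⟩

omit [DecidableEq ι] in
lemma orthogonal_dotProductBilin (V : Submodule F (ι → F)) :
    LinearMap.BilinForm.orthogonal (dotProductBilin F F) V = perp V := by
  ext ξ
  rw [LinearMap.BilinForm.mem_orthogonal_iff]
  refine forall₂_congr fun v _ => ?_
  change v ⬝ᵥ ξ = 0 ↔ _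
  rw [dotProduct_comm]

lemma finrank_perp (V : Submodule F (ι → F)) :
    finrank F (perp V) = Fintype.card ι - finrank F V := by
  rw [← orthogonal_dotProductBilin,
    LinearMap.BilinForm.finrank_orthogonal nondegenerate_dotProductBilin,
    finrank_fintype_fun_eq_card]

lemma mem_of_forall_mem_perp {V : Submodule F (ι → F)} {v : ι → F}
    (hv : ∀ ξ ∈ perp V, ξ ⬝ᵥ v = 0) : v ∈ V := by
  have hsymm : (dotProductBilin F F : LinearMap.BilinForm F (ι → F)).IsSymm :=
    ⟨fun x y => dotProduct_comm x y⟩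
  rw [← LinearMap.BilinForm.orthogonal_orthogonal nondegenerate_dotProductBilin hsymm.isRefl V,
    orthogonal_dotProductBilin V, LinearMap.BilinForm.mem_orthogonal_iff]
  exact hv

end Perp

section

variable {F : Type*} [Field F] [Fintype F] {ι : Type*} [Fintype ι] [DecidableEq ι]

lemma card_perp (V : Submodule F (ι → F)) :
    (Fintype.card (perp V) : ℝ) = (Fintype.card F : ℝ) ^ (Fintype.card ι - finrank F V) := by
  rw [Module.card_eq_pow_finrank (K := F), finrank_perp V]; push_cast; rfl

omit [Fintype F] in
lemma exists_determining_coordinates (V : Submodule F (ι → F)) :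
    ∃ J : Finset ι, J.card ≤ finrank F V ∧ ∀ v ∈ V, (∀ j ∈ J, v j = 0) → v = 0 := by
  let c : ι → Dual F V := fun i => (LinearMap.proj i).comp V.subtype
  obtain ⟨κ, f, hf, hspan, hli⟩ := exists_linearIndependent' F c
  have : Fintype κ := Fintype.ofInjective f hf
  refine ⟨univ.image f, ?_, fun v hv h => ?_⟩
  · rw [Finset.card_image_of_injective _ hf, Finset.card_univ, ← Subspace.dual_finrank_eq]
    exact hli.fintype_card_le_finrank
  · funext i
    have h1 : c i ∈ Submodule.span F (Set.range (c ∘ f)) := by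
      rw [hspan]; exact Submodule.subset_span ⟨i, rfl⟩
    have h2 : ∀ d ∈ Submodule.span F (Set.range (c ∘ f)), d ⟨v, hv⟩ = 0 := by
      intro d hd
      induction hd using Submodule.span_induction with
      | mem x hx =>
        obtain ⟨k, rfl⟩ := hx
        exact h (f k) (Finset.mem_image_of_mem _ (Finset.mem_univ k))
      | zero => rfl
      | add x y _ _ hx hy => rw [LinearMap.add_apply, hx, hy, add_zero]
      | smul a x _ hx => rw [LinearMap.smul_apply, hx, smul_zero]
    exact h2 _ h1

/-- Odlyzko's bound: a subspace is determined by as many coordinates as its dimension, and each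
of the remaining coordinates takes its prescribed value with probability at most `a`. -/
lemma mass_submodule_le {w : F → ℝ} (hw : IsWeight w) {a : ℝ} (ha : ∀ x, w x ≤ a) (ha1 : a ≤ 1)
    (V : Submodule F (ι → F)) :
    mass (prodWt w) (fun v => v ∈ V) ≤ a ^ (Fintype.card ι - finrank F V) := by
  have ha0 : 0 ≤ a := (hw.nonneg 0).trans (ha 0)
  obtain ⟨J, hJ, hdet⟩ := exists_determining_coordinates V
  obtain ⟨R, hRdef⟩ : ∃ R : (J → F) → ι → F → Prop, ∀ y i b,
      R y i b ↔ ∃ v ∈ V, (fun j : J => v j) = y ∧ v i = b := ⟨_, fun _ _ _ => Iff.rfl⟩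
  have hR : ∀ y i, mass w (R y i) ≤ a := by
    intro y i
    by_cases h : ∃ v ∈ V, (fun j : J => v j) = y
    · obtain ⟨v, hv, hvy⟩ := h
      refine le_trans (hw.mass_mono (R := fun b => b = v i) ?_) ?_
      · intro b hb
        obtain ⟨v', hv', hvy', rfl⟩ := (hRdef _ _ _).1 hb
        have h3 := hdet (v' - v) (V.sub_mem hv' hv) fun j hj => by
          have := congrFun (hvy'.trans hvy.symm) ⟨j, hj⟩
          simpa [sub_eq_zero] using this
        rw [sub_eq_zero.1 h3]
      · simpa [mass] using ha (v i)
    · refine le_trans (le_of_eq ?_) ha0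
      exact Finset.sum_eq_zero fun b _ => if_neg fun hb =>
        let ⟨v, hv, hvy, _⟩ := (hRdef _ _ _).1 hb
        h ⟨v, hv, hvy⟩
  calc mass (prodWt w) (fun v => v ∈ V)
      ≤ ∑ x : ι → F, prodWt w x *
          (if ∀ i, i ∉ J → R (fun j : J => x j) i (x i) then (1 : ℝ) else 0) := by
        rw [mass_eq_sum_mul]
        refine Finset.sum_le_sum fun x _ => mul_le_mul_of_nonneg_left ?_ (hw.prodWt.nonneg x)
        by_cases hx : x ∈ V
        · rw [if_pos hx, if_pos fun i _ => (hRdef _ _ _).2 ⟨x, hx, rfl, rfl⟩]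
        · rw [if_neg hx]; split_ifs <;> norm_num
    _ = ∑ y : J → F, prodWt w y * (1 * ∏ i : {i // i ∉ J}, mass w (R y i)) :=
        sum_prodWt_split w J (fun _ => 1) R
    _ ≤ ∑ y : J → F, prodWt w y * a ^ (Fintype.card ι - J.card) := by
        refine Finset.sum_le_sum fun y _ => mul_le_mul_of_nonneg_left ?_ (hw.prodWt.nonneg y)
        rw [one_mul, ← card_notMem, ← Finset.card_univ, ← Finset.prod_const]
        exact Finset.prod_le_prod (fun i _ => hw.mass_nonneg _) fun i _ => hR y i
    _ = a ^ (Fintype.card ι - J.card) := by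
        rw [← Finset.sum_mul, hw.prodWt.sum_eq_one, one_mul]
    _ ≤ _ := pow_le_pow_of_le_one ha0 ha1 (by omega)

variable {ψ : AddChar F ℂ} {w : F → ℝ} {α : ℝ}

/-- The law of the difference of two samples, kept with probability `lam` and replaced by `0`
otherwise. -/
noncomputable def lazyWeight (lam : ℝ) (w : F → ℝ) (x : F) : ℝ :=
  (1 - lam) * (if x = 0 then 1 else 0) + lam * ∑ b, w (x + b) * w b

lemma isWeight_lazyWeight (hw : IsWeight w) {lam : ℝ} (h0 : 0 ≤ lam) (h1 : lam ≤ 1) :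
    IsWeight (lazyWeight lam w) where
  nonneg x := by
    have : 0 ≤ ∑ b, w (x + b) * w b :=
      Finset.sum_nonneg fun b _ => mul_nonneg (hw.nonneg _) (hw.nonneg _)
    have : (0 : ℝ) ≤ if x = 0 then 1 else 0 := by split_ifs <;> norm_num
    have : 0 ≤ 1 - lam := by linarith
    unfold lazyWeight
    positivity
  sum_eq_one := by
    unfold lazyWeight
    rw [Finset.sum_add_distrib, ← Finset.mul_sum, ← Finset.mul_sum, Finset.sum_comm]
    have : ∀ b, ∑ x, w (x + b) * w b = w b := fun b => by
      have h : ∑ x, w (x + b) = ∑ x, w x := Equiv.sum_comp (Equiv.addRight b) w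
      rw [← Finset.sum_mul, h, hw.sum_eq_one, one_mul]
    simp [this, hw.sum_eq_one]

lemma lazyWeight_le (hw : IsWeight w) (hα : ∀ x, w x ≤ 1 - α) (hα1 : α ≤ 1) {lam : ℝ}
    (h0 : 0 ≤ lam) (h1 : lam ≤ 1 / 2) (x : F) : lazyWeight lam w x ≤ 1 - lam * α := by
  have hα' : 0 ≤ 1 - α := by linarith
  have h2 : ∑ b, w (x + b) * w b ≤ 1 - α := by
    calc _ ≤ ∑ b, (1 - α) * w b :=
          Finset.sum_le_sum fun b _ => mul_le_mul_of_nonneg_right (hα _) (hw.nonneg b)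
      _ = _ := by rw [← Finset.mul_sum, hw.sum_eq_one, mul_one]
  have h3 := mul_le_mul_of_nonneg_left h2 h0
  unfold lazyWeight
  split_ifs <;> nlinarith

lemma charFn_lazyWeight (hw : IsWeight w) (lam : ℝ) (x : F) :
    charFn ψ (lazyWeight lam w) x = ((1 - lam * energy ψ w x : ℝ) : ℂ) := by
  have h1 : ∑ a, (∑ b, (w (a + b) : ℂ) * w b) * ψ (x * a) = ((1 - energy ψ w x : ℝ) : ℂ) := by
    rw [← norm_charFn_sq hw, coe_norm_charFn_sq]
    simp only [Finset.sum_mul]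
    rw [Finset.sum_comm, Finset.sum_comm (f := fun a b => (w a : ℂ) * w b * ψ (x * (a - b)))]
    refine Finset.sum_congr rfl fun b _ => ?_
    rw [← Equiv.sum_comp (Equiv.addRight b) fun a => (w a : ℂ) * w b * ψ (x * (a - b))]
    exact Finset.sum_congr rfl fun a _ => by simp
  calc charFn ψ (lazyWeight lam w) x
      = (1 - lam) * ∑ a, (if a = 0 then (1 : ℂ) else 0) * ψ (x * a) +
        lam * ∑ a, (∑ b, (w (a + b) : ℂ) * w b) * ψ (x * a) := by
        unfold charFn lazyWeight
        rw [Finset.mul_sum, Finset.mul_sum, ← Finset.sum_add_distrib]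
        refine Finset.sum_congr rfl fun a _ => ?_
        push_cast
        split_ifs <;> push_cast <;> ring
    _ = _ := by
        rw [h1]; simp; ring

lemma exp_neg_two_mul_le {y : ℝ} (h0 : 0 ≤ y) (h1 : y ≤ 1 / 2) : Real.exp (-(2 * y)) ≤ 1 - y := by
  have h2 := Real.add_one_le_exp (2 * y)
  rw [Real.exp_neg, inv_le_comm₀ (Real.exp_pos _) (by linarith)]
  refine le_trans ?_ h2
  rw [inv_le_iff_one_le_mul₀ (by linarith)]
  nlinarith

/-- The total energy of a vector. -/
noncomputable def totalEnergy (ψ : AddChar F ℂ) (w : F → ℝ) (x : ι → F) : ℝ :=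
  ∑ i, energy ψ w (x i)

omit [DecidableEq ι] in
lemma isSpread_totalEnergy (hψ : ψ ≠ 1) (hw : IsWeight w) (hα : IsDenseWeight α w) (hα0 : 0 ≤ α)
    {G : Type*} [AddCommGroup G] [Module F G] [Fintype G] (φ : G →ₗ[F] (ι → F)) {s : ℝ}
    (hs : ∀ g, g ≠ 0 → s ≤ (univ.filter fun i => φ g i ≠ 0).card) :
    IsSpread (fun g => totalEnergy ψ w (φ g)) (α * s) :=
  isSpread_sum_energy hψ hw hα hα0
    (fun i => ((LinearMap.proj i).comp φ : G →ₗ[F] F).toAddMonoidHom) hs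

end

/-! ### Fourier bounds for the mass of a subspace -/

section

variable {F : Type*} [Field F] [Fintype F] {ι : Type*} [Fintype ι] [DecidableEq ι]
variable {ψ : AddChar F ℂ} {w : F → ℝ} {α : ℝ}

lemma mass_submodule_eq (hψ : ψ ≠ 1) (w : F → ℝ) (V : Submodule F (ι → F)) :
    (mass (prodWt w) (fun v => v ∈ V) : ℂ) =
      (Fintype.card (perp V) : ℂ)⁻¹ * ∑ g : perp V, ∏ i, charFn ψ w ((g : ι → F) i) := by
  refine Eq.trans ?_ (mass_annihilator hψ w (perp V).subtype)
  congr 2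
  funext v
  exact propext ⟨fun h g => g.2 v h, fun h => mem_of_forall_mem_perp fun ξ hξ => h ⟨ξ, hξ⟩⟩

lemma charFn_zero (hw : IsWeight w) : charFn ψ w 0 = 1 := by
  unfold charFn
  simp only [zero_mul, AddChar.map_zero_eq_one, mul_one]
  exact_mod_cast hw.sum_eq_one

/-- The mass of `V` differs from the uniform measure of `V` by the average of the nontrivial
Fourier coefficients over the orthogonal space. -/
lemma abs_mass_sub_le (hψ : ψ ≠ 1) (hw : IsWeight w) (V : Submodule F (ι → F)) :
    |mass (prodWt w) (fun v => v ∈ V) - (Fintype.card (perp V) : ℝ)⁻¹| ≤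
      (Fintype.card (perp V) : ℝ)⁻¹ *
        ∑ g ∈ univ.filter (fun g : perp V => g ≠ 0), ∏ i, ‖charFn ψ w ((g : ι → F) i)‖ := by
  have h1 := mass_submodule_eq hψ w V
  have h2 : (univ : Finset (perp V)) = insert 0 (univ.filter fun g : perp V => g ≠ 0) := by
    ext g; by_cases h : g = 0 <;> simp [h]
  rw [h2, Finset.sum_insert (by simp)] at h1
  simp only [Submodule.coe_zero, Pi.zero_apply, charFn_zero hw, Finset.prod_const_one] at h1
  have h3 : ((mass (prodWt w) (fun v => v ∈ V) - (Fintype.card (perp V) : ℝ)⁻¹ : ℝ) : ℂ) =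
      (Fintype.card (perp V) : ℂ)⁻¹ *
        ∑ g ∈ univ.filter (fun g : perp V => g ≠ 0), ∏ i, charFn ψ w ((g : ι → F) i) := by
    push_cast
    rw [h1]; ring
  rw [← Real.norm_eq_abs, ← Complex.norm_real, h3, norm_mul, norm_inv, Complex.norm_natCast]
  refine mul_le_mul_of_nonneg_left ((norm_sum_le _ _).trans ?_) (by positivity)
  exact Finset.sum_le_sum fun g _ => (Complex.norm_prod _ _).le

/-- If all nontrivial Fourier coefficients on the orthogonal space are at most `t`, then the
mass of `V` is within `t` of its uniform measure. -/
lemma abs_mass_sub_le_of_forall (hψ : ψ ≠ 1) (hw : IsWeight w) (V : Submodule F (ι → F)) {t : ℝ}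
    (ht0 : 0 ≤ t) (ht : ∀ ξ ∈ perp V, ξ ≠ 0 → ∏ i, ‖charFn ψ w (ξ i)‖ ≤ t) :
    |mass (prodWt w) (fun v => v ∈ V) - (Fintype.card (perp V) : ℝ)⁻¹| ≤ t := by
  refine (abs_mass_sub_le hψ hw V).trans ?_
  have h1 : ∑ g ∈ univ.filter (fun g : perp V => g ≠ 0), ∏ i, ‖charFn ψ w ((g : ι → F) i)‖ ≤
      ∑ _g : perp V, t := by
    refine (Finset.sum_le_sum (g := fun _ => t) fun (g : perp V) hg => ht g g.2 ?_).trans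
      (Finset.sum_le_sum_of_subset_of_nonneg (Finset.subset_univ _) fun _ _ _ => ht0)
    exact fun h => (Finset.mem_filter.1 hg).2 (Subtype.ext h)
  rw [Finset.sum_const, Finset.card_univ, nsmul_eq_mul] at h1
  have hG : (0 : ℝ) < Fintype.card (perp V) := by exact_mod_cast Fintype.card_pos
  rw [inv_mul_le_iff₀ hG]
  exact h1

/-- A lower bound for the mass of `V` under the lazy weight, whose Fourier transform is
nonnegative. -/
lemma sum_exp_le_mass_lazyWeight (hψ : ψ ≠ 1) (hw : IsWeight w) {lam : ℝ} (h0 : 0 ≤ lam)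
    (h1 : lam ≤ 1 / 2) (V : Submodule F (ι → F)) :
    (Fintype.card (perp V) : ℝ)⁻¹ *
        ∑ g : perp V, Real.exp (-(2 * lam * totalEnergy ψ w (g : ι → F))) ≤
      mass (prodWt (lazyWeight lam w)) (fun v => v ∈ V) := by
  have h2 := mass_submodule_eq hψ (lazyWeight lam w) V
  simp only [charFn_lazyWeight hw] at h2
  have h3 : mass (prodWt (lazyWeight lam w)) (fun v => v ∈ V) = (Fintype.card (perp V) : ℝ)⁻¹ *
      ∑ g : perp V, ∏ i, (1 - lam * energy ψ w ((g : ι → F) i)) := by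
    apply Complex.ofReal_injective
    rw [h2]; push_cast; rfl
  rw [h3]
  refine mul_le_mul_of_nonneg_left (Finset.sum_le_sum fun g _ => ?_) (by positivity)
  rw [totalEnergy, Finset.mul_sum, ← Finset.sum_neg_distrib, Real.exp_sum]
  refine Finset.prod_le_prod (fun i _ => (Real.exp_pos _).le) fun i _ => ?_
  have h4 := energy_nonneg (ψ := ψ) hw ((g : ι → F) i)
  have h5 := energy_le_one (ψ := ψ) hw ((g : ι → F) i)
  rw [mul_assoc]
  exact exp_neg_two_mul_le (mul_nonneg h0 h4) (by nlinarith)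

/-- A Halász-type comparison: if all nonzero vectors orthogonal to `V` have large support, then,
apart from the contribution of the trivial character, `V` is much more likely to contain a lazy
sample than an ordinary one. Passing to the lazy weight divides the energies in the exponents by
`16 ^ j`, and the level sets of the energy grow by `2 ^ j` when the level is multiplied by
`16 ^ j`. The level `u₀`, above which this growth is not available, leaves an exponentially small
error. -/
lemma mass_le_lazyWeight (hψ : ψ ≠ 1) (hw : IsWeight w) (hα : IsDenseWeight α w) (hα0 : 0 ≤ α)
    (V : Submodule F (ι → F)) {s : ℝ}
    (hs : ∀ ξ ∈ perp V, ξ ≠ 0 → s ≤ (univ.filter fun i => ξ i ≠ 0).card)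
    {j : ℕ} (hj : 1 ≤ j) {u₀ : ℝ} (hu₀ : 0 ≤ u₀) (hu : 16 ^ j * u₀ < α * s) :
    mass (prodWt w) (fun v => v ∈ V) ≤ (Fintype.card (perp V) : ℝ)⁻¹ +
      ((2 ^ j)⁻¹ + Real.exp (-(u₀ / 4))) *
        mass (prodWt (lazyWeight ((16 ^ j)⁻¹ / 4) w)) (fun v => v ∈ V) := by
  set G := perp V with hG
  set R : ℝ := 16 ^ j with hR
  have hR16 : 16 ≤ R := by
    rw [hR]; calc (16 : ℝ) = 16 ^ 1 := by norm_num
      _ ≤ 16 ^ j := pow_le_pow_right₀ (by norm_num) hj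
  have hR0 : 0 < R := by linarith
  obtain ⟨N, hNdef⟩ : ∃ N : G → ℝ, N = fun g : G => totalEnergy ψ w (g : ι → F) := ⟨_, rfl⟩
  have hN : IsSpread N (α * s) := hNdef ▸ isSpread_totalEnergy hψ hw hα hα0 G.subtype
    fun g hg => hs g g.2 fun h => hg (Subtype.ext h)
  have hgrow := sum_exp_le_of_growth (N := N) (M := 2 ^ j) (R := R) (u₀ := u₀) hR0 hN.zero
    hN.nonneg (fun u h0 h1 => hN.growth_iterate h0 j
      (lt_of_le_of_lt (mul_le_mul_of_nonneg_left h1 hR0.le) hu)) hu₀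
  have hlazy := sum_exp_le_mass_lazyWeight (ψ := ψ) hψ hw (lam := R⁻¹ / 4) (by positivity)
    (by
      have : R⁻¹ ≤ 1 := inv_le_one_of_one_le₀ (by linarith)
      linarith) V
  set m := mass (prodWt (lazyWeight (R⁻¹ / 4) w)) (fun v => v ∈ V)
  have hc : (0 : ℝ) < (Fintype.card G : ℝ)⁻¹ := by
    have : (0 : ℝ) < Fintype.card G := by exact_mod_cast Fintype.card_pos
    positivity
  set S : ℝ := ∑ g : G, Real.exp (-(2 * (R⁻¹ / 4) * totalEnergy ψ w (g : ι → F))) with hS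
  have hNexp : ∀ g, Real.exp (-(N g / (2 * R))) =
      Real.exp (-(2 * (R⁻¹ / 4) * totalEnergy ψ w (g : ι → F))) := fun g => by
    rw [hNdef]
    congr 2
    field_simp; ring
  have hsmall : ∑ g ∈ univ.filter (fun g => g ≠ 0 ∧ N g ≤ u₀), Real.exp (-(N g / 2)) ≤
      (2 ^ j)⁻¹ * S := by
    rw [le_inv_mul_iff₀ (by positivity)]
    refine hgrow.trans ?_
    simp only [hNexp]
    exact Finset.sum_le_sum_of_subset_of_nonneg (Finset.subset_univ _)
      fun _ _ _ => (Real.exp_pos _).le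
  have hlarge : ∑ g ∈ univ.filter (fun g => g ≠ 0 ∧ ¬ N g ≤ u₀), Real.exp (-(N g / 2)) ≤
      Real.exp (-(u₀ / 4)) * S := by
    rw [hS, Finset.mul_sum]
    refine (Finset.sum_le_sum fun g hg => ?_).trans
      (Finset.sum_le_sum_of_subset_of_nonneg (Finset.subset_univ _)
        fun _ _ _ => mul_nonneg (Real.exp_pos _).le (Real.exp_pos _).le)
    have hg' := (Finset.mem_filter.1 hg).2.2
    rw [← hNexp, ← Real.exp_add, Real.exp_le_exp]
    have h1 : N g / (2 * R) ≤ N g / 4 := by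
      apply div_le_div_of_nonneg_left (hN.nonneg g) (by norm_num) (by linarith)
    linarith
  have hsplit : ∑ g ∈ univ.filter (fun g : G => g ≠ 0), Real.exp (-(N g / 2)) ≤
      ((2 ^ j)⁻¹ + Real.exp (-(u₀ / 4))) * S := by
    rw [← Finset.sum_filter_add_sum_filter_not _ (fun g => N g ≤ u₀), Finset.filter_filter,
      Finset.filter_filter, add_mul]
    exact add_le_add hsmall hlarge
  have h1 := (le_abs_self _).trans (abs_mass_sub_le hψ hw V)
  have h2 : ∑ g ∈ univ.filter (fun g : G => g ≠ 0), ∏ i, ‖charFn ψ w ((g : ι → F) i)‖ ≤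
      ((2 ^ j)⁻¹ + Real.exp (-(u₀ / 4))) * S :=
    (Finset.sum_le_sum fun g _ => hNdef ▸ prod_norm_charFn_le hw _).trans hsplit
  have h3 := mul_le_mul_of_nonneg_left h2 hc.le
  have h4 := mul_le_mul_of_nonneg_left hlazy
    (show 0 ≤ (2 ^ j : ℝ)⁻¹ + Real.exp (-(u₀ / 4)) by positivity)
  linarith

/-- The mass of a hyperplane in terms of the size of the support of its normal vector. -/
lemma mass_hyperplane_le (hψ : ψ ≠ 1) (hw : IsWeight w) (hα : IsDenseWeight α w) (hα0 : 0 < α)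
    {ξ : ι → F} (hξ : ξ ≠ 0) :
    mass (prodWt w) (fun v => ξ ⬝ᵥ v = 0) ≤
      (1 + Real.exp (-(α * (univ.filter fun i => ξ i ≠ 0).card / 1024))) / 2 := by
  set s : ℕ := (univ.filter fun i => ξ i ≠ 0).card with hs
  have hs0 : 0 < s := by
    obtain ⟨i, hi⟩ := Function.ne_iff.1 hξ
    exact Finset.card_pos.2 ⟨i, by simpa using hi⟩
  let φ : F →ₗ[F] (ι → F) := LinearMap.toSpanSingleton F (ι → F) ξ
  have hφ : ∀ t, φ t = t • ξ := fun t => rfl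
  let N : F → ℝ := fun t => totalEnergy ψ w (φ t)
  have hN : IsSpread N (α * s) := isSpread_totalEnergy hψ hw hα hα0.le φ fun t ht => by
    rw [hs]; simp [hφ, ht]
  set u : ℝ := α * s / 512 with hu
  have hs0' : (0 : ℝ) < s := by exact_mod_cast hs0
  have hu0 : 0 < u := by positivity
  have hq : (2 : ℝ) ≤ Fintype.card F := by exact_mod_cast Fintype.one_lt_card
  have hlev : levelCard N u ≤ Fintype.card F / 2 := by
    have h16 : 16 ^ 2 * u < α * s := by
      have : 0 < α * s := by positivity
      rw [hu]; linarith
    rcases hN.levelCard_le hu0.le 2 h16 with h | h <;> linarith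
  have hmass : mass (prodWt w) (fun v => ξ ⬝ᵥ v = 0) ≤
      (Fintype.card F : ℝ)⁻¹ * ∑ t, Real.exp (-(N t / 2)) := by
    have h1 := mass_annihilator hψ w φ
    have h2 : (fun v : ι → F => ∀ t, φ t ⬝ᵥ v = 0) = fun v => ξ ⬝ᵥ v = 0 := by
      funext v
      refine propext ⟨fun h => by simpa [hφ] using h 1, fun h t => ?_⟩
      rw [hφ, smul_dotProduct, h, smul_zero]
    rw [h2] at h1
    calc mass (prodWt w) (fun v => ξ ⬝ᵥ v = 0)
        ≤ ‖(mass (prodWt w) (fun v => ξ ⬝ᵥ v = 0) : ℂ)‖ := by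
          rw [Complex.norm_real]; exact Real.le_norm_self _
      _ ≤ _ := by
          rw [h1, norm_mul, norm_inv, Complex.norm_natCast]
          refine mul_le_mul_of_nonneg_left ((norm_sum_le _ _).trans ?_) (by positivity)
          exact Finset.sum_le_sum fun t _ =>
            (Complex.norm_prod _ _).le.trans (prod_norm_charFn_le hw _)
  refine hmass.trans ?_
  have hsum : ∑ t, Real.exp (-(N t / 2)) ≤
      ∑ t, (Real.exp (-(u / 2)) + (1 - Real.exp (-(u / 2))) * (if N t ≤ u then 1 else 0)) := by
    refine Finset.sum_le_sum fun t _ => ?_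
    split_ifs with h
    · have := Real.exp_le_one_iff.2 (show -(N t / 2) ≤ 0 by have := hN.nonneg t; linarith)
      linarith
    · have := Real.exp_le_exp.2 (show -(N t / 2) ≤ -(u / 2) by push Not at h; linarith)
      linarith
  have h3 : ∑ t, (Real.exp (-(u / 2)) + (1 - Real.exp (-(u / 2))) * (if N t ≤ u then 1 else 0)) =
      Fintype.card F * Real.exp (-(u / 2)) + (1 - Real.exp (-(u / 2))) * levelCard N u := by
    rw [Finset.sum_add_distrib, ← Finset.mul_sum, Finset.sum_boole, levelCard]
    simp
  rw [h3] at hsum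
  have h4 : Real.exp (-(u / 2)) ≤ 1 := Real.exp_le_one_iff.2 (by linarith)
  have h5 : u / 2 = α * s / 1024 := by rw [hu]; ring
  rw [← h5, inv_mul_le_iff₀ (by linarith)]
  nlinarith

end

/-! ### Sparse normal vectors -/

/-- Chernoff's bound for the number of small subsets. -/
lemma card_finset_card_le {κ : Type*} [Fintype κ] (m : ℕ) {x : ℝ} (h0 : 0 < x) (h1 : x ≤ 1) :
    ((univ.filter fun I : Finset κ => I.card ≤ m).card : ℝ) * x ^ m ≤
      (1 + x) ^ Fintype.card κ := by
  calc _ = ∑ I ∈ univ.filter (fun I : Finset κ => I.card ≤ m), x ^ m := by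
        rw [Finset.sum_const, nsmul_eq_mul]
    _ ≤ ∑ I ∈ univ.filter (fun I : Finset κ => I.card ≤ m), x ^ I.card :=
        Finset.sum_le_sum fun I hI => pow_le_pow_of_le_one h0.le h1 (Finset.mem_filter.1 hI).2
    _ ≤ ∑ I : Finset κ, x ^ I.card :=
        Finset.sum_le_sum_of_subset_of_nonneg (Finset.subset_univ _) fun _ _ _ => by positivity
    _ = _ := by
        rw [add_comm, ← Fintype.sum_pow_mul_eq_add_pow]; simp

section

variable {F : Type*} [Field F] {ι : Type*} [Fintype ι] [DecidableEq ι] {κ : Type*} [Fintype κ]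
  [DecidableEq κ]

/-- The support of a vector. -/
noncomputable def vsupp (ξ : ι → F) : Finset ι := univ.filter fun i => ξ i ≠ 0

omit [DecidableEq ι] in
lemma dotProduct_eq_restrict {S : Finset ι} {ξ : ι → F} (hξ : vsupp ξ = S) (x : ι → F) :
    ξ ⬝ᵥ x = (fun j : S => ξ j) ⬝ᵥ (fun j : S => x j) := by
  unfold dotProduct
  rw [Finset.sum_coe_sort S fun i => ξ i * x i]
  refine (Finset.sum_subset (Finset.subset_univ S) fun i _ hi => ?_).symm
  have : ξ i = 0 := by
    by_contra h
    exact hi (hξ ▸ by simp [vsupp, h])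
  rw [this, zero_mul]

/-- If some vector with support exactly `S` is orthogonal to all `X i`, then fewer than `|S|` of
the `X i` already decide which vectors supported on `S` are orthogonal to all of them. -/
lemma exists_deciding_rows {S : Finset ι} {ξ : ι → F} (hξ : vsupp ξ = S) (hS : S.Nonempty)
    (X : κ → ι → F) (h : ∀ i, ξ ⬝ᵥ X i = 0) :
    ∃ I : Finset κ, I.card < S.card ∧
      ∀ ξ' : ι → F, vsupp ξ' = S → (∀ i ∈ I, ξ' ⬝ᵥ X i = 0) → ∀ i, ξ' ⬝ᵥ X i = 0 := by
  let Z : κ → S → F := fun i j => X i j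
  obtain ⟨κ', f, hf, hspan, hli⟩ := exists_linearIndependent' F Z
  have : Fintype κ' := Fintype.ofInjective f hf
  refine ⟨univ.image f, ?_, fun ξ' hξ' h' i => ?_⟩
  · rw [Finset.card_image_of_injective _ hf, Finset.card_univ, ← finrank_span_eq_card hli, hspan]
    have hmem : (fun j : S => ξ j) ∈ perp (Submodule.span F (Set.range Z)) :=
      mem_perp_span.2 fun i => by rw [← h i, dotProduct_eq_restrict hξ]
    have hne : (fun j : S => ξ j) ≠ 0 := by
      obtain ⟨j, hj⟩ := hS
      have hj' := hξ ▸ hj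
      exact fun H => (Finset.mem_filter.1 hj').2 (congrFun H ⟨j, hj⟩)
    have hpos : 0 < finrank F (perp (Submodule.span F (Set.range Z))) :=
      finrank_pos_iff_exists_ne_zero.2 ⟨⟨_, hmem⟩, fun H => hne (congrArg Subtype.val H)⟩
    rw [finrank_perp _, Fintype.card_coe] at hpos
    omega
  · have hmem : (fun j : S => ξ' j) ∈ perp (Submodule.span F (Set.range (Z ∘ f))) :=
      mem_perp_span.2 fun k => by
        rw [← h' (f k) (Finset.mem_image_of_mem _ (Finset.mem_univ k)),
          dotProduct_eq_restrict hξ']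
        rfl
    rw [dotProduct_eq_restrict hξ']
    rw [hspan] at hmem
    exact mem_perp_span.1 hmem i

variable [Fintype F]

/-- The probability that some vector with support `S` is orthogonal to all of the samples. -/
lemma mass_support_eq_le {p : (ι → F) → ℝ} (hp : IsWeight p) {S : Finset ι} (hS : S.Nonempty)
    {ρ : ℝ} (hρ1 : ρ ≤ 1) (hρ : ∀ ξ : ι → F, vsupp ξ = S → mass p (fun v => ξ ⬝ᵥ v = 0) ≤ ρ)
    (hρ0 : 0 ≤ ρ) :
    mass (prodWt p) (fun X : κ → ι → F => ∃ ξ : ι → F, vsupp ξ = S ∧ ∀ i, ξ ⬝ᵥ X i = 0) ≤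
      (univ.filter fun I : Finset κ => I.card ≤ S.card).card *
        ρ ^ (Fintype.card κ - S.card) := by
  obtain ⟨good, hgood⟩ : ∃ good : (I : Finset κ) → (I → ι → F) → Prop, ∀ I y, good I y ↔
      ∃ ξ : ι → F, vsupp ξ = S ∧ ∀ j, ξ ⬝ᵥ y j = 0 := ⟨_, fun _ _ => Iff.rfl⟩
  obtain ⟨sel, hsel⟩ : ∃ sel : (I : Finset κ) → (I → ι → F) → ι → F, ∀ I y, good I y →
      vsupp (sel I y) = S ∧ ∀ j, sel I y ⬝ᵥ y j = 0 := by
    have : ∀ (I : Finset κ) (y : I → ι → F), ∃ ξ : ι → F, good I y →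
        vsupp ξ = S ∧ ∀ j, ξ ⬝ᵥ y j = 0 := fun I y => by
      by_cases h : good I y
      · obtain ⟨ξ, hξ⟩ := (hgood I y).1 h
        exact ⟨ξ, fun _ => hξ⟩
      · exact ⟨0, fun h' => absurd h' h⟩
    choose sel hsel using this
    exact ⟨sel, hsel⟩
  have hterm : ∀ I : Finset κ, I.card ≤ S.card →
      mass (prodWt p) (fun X : κ → ι → F => good I (fun j => X j) ∧
        ∀ i, i ∉ I → sel I (fun j => X j) ⬝ᵥ X i = 0) ≤ ρ ^ (Fintype.card κ - S.card) := by
    intro I hI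
    have h1 := sum_prodWt_split p I (fun y => if good I y then (1 : ℝ) else 0)
      (fun y _ v => sel I y ⬝ᵥ v = 0)
    rw [mass_eq_sum_mul]
    calc _ = _ := Finset.sum_congr rfl fun X _ => by
          congr 1
          by_cases ha : good I (fun j => X j) <;>
          by_cases hb : ∀ i, i ∉ I → sel I (fun j => X j) ⬝ᵥ X i = 0 <;> simp [ha, hb]
      _ = _ := h1
      _ ≤ ∑ y : I → ι → F, prodWt p y * ρ ^ (Fintype.card κ - S.card) := by
          refine Finset.sum_le_sum fun y _ => mul_le_mul_of_nonneg_left ?_ (hp.prodWt.nonneg y)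
          by_cases ha : good I y
          · rw [if_pos ha, one_mul]
            refine (Finset.prod_le_prod (fun i _ => hp.mass_nonneg _)
              fun i _ => hρ _ (hsel I y ha).1).trans ?_
            rw [Finset.prod_const, Finset.card_univ, card_notMem]
            exact pow_le_pow_of_le_one hρ0 hρ1 (by omega)
          · rw [if_neg ha, zero_mul]; positivity
      _ = _ := by rw [← Finset.sum_mul, hp.prodWt.sum_eq_one, one_mul]
  refine (hp.prodWt.mass_exists_le (univ.filter fun I : Finset κ => I.card ≤ S.card) _
    (fun I X => good I (fun j => X j) ∧ ∀ i, i ∉ I → sel I (fun j => X j) ⬝ᵥ X i = 0)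
    ?_).trans ?_
  · rintro X ⟨ξ, hξ, h⟩
    obtain ⟨I, hI, hdec⟩ := exists_deciding_rows hξ hS X h
    have hg : good I (fun j => X j) := (hgood _ _).2 ⟨ξ, hξ, fun j => h j⟩
    refine ⟨I, by simp [hI.le], hg, fun i _ => ?_⟩
    obtain ⟨h1, h2⟩ := hsel I _ hg
    exact hdec _ h1 (fun i hi => h2 ⟨i, hi⟩) i
  · refine (Finset.sum_le_sum fun I hI => hterm I (Finset.mem_filter.1 hI).2).trans ?_
    rw [Finset.sum_const, nsmul_eq_mul]

end

/-- The sparsity threshold, as a proportion of the dimension. -/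
noncomputable def sparseRatio : ℝ := (2 ^ 20)⁻¹

lemma half_one_add_exp_le {t : ℝ} (ht : 0 ≤ t) :
    (1 + Real.exp (-(t / 1024))) / 2 ≤ Real.exp (-(min t 1 / 4096)) := by
  set m := min t 1 with hm
  have h0 : 0 ≤ m := le_min ht zero_le_one
  have h1 : m ≤ 1 := min_le_right _ _
  have h2 : Real.exp (-(t / 1024)) ≤ Real.exp (-(2 * (m / 2048))) := by
    rw [Real.exp_le_exp]; have := min_le_left t 1; linarith
  have h3 := exp_neg_two_mul_le (y := m / 2048) (by linarith) (by linarith)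
  have h4 := Real.add_one_le_exp (-(m / 4096))
  linarith

lemma one_add_inv_pow_le {n : ℕ} (hn : (0 : ℝ) < n) : (1 + (n : ℝ)⁻¹) ^ n ≤ Real.exp 1 := by
  calc (1 + (n : ℝ)⁻¹) ^ n ≤ Real.exp (n : ℝ)⁻¹ ^ n :=
        pow_le_pow_left₀ (by positivity) (by linarith [Real.add_one_le_exp (n : ℝ)⁻¹]) n
    _ = Real.exp 1 := by rw [← Real.exp_nat_mul, mul_inv_cancel₀ hn.ne']

section

variable {F : Type*} [Field F] [Fintype F] {ψ : AddChar F ℂ} {w : F → ℝ} {α : ℝ}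

/-- With overwhelming probability no sparse vector is orthogonal to all of the first rows. -/
lemma mass_sparse_le (hψ : ψ ≠ 1) (hw : IsWeight w) (hα : IsDenseWeight α w) (hα0 : 0 < α)
    (hα1 : α < 1) {n k : ℕ} (hn : 2 ≤ n) (hk : 3 * n ≤ 4 * k) (hkn : k ≤ n)
    (hlog : 2 ^ 15 * Real.log n ≤ α * n) :
    mass (prodWt (prodWt w)) (fun X : Fin k → Fin n → F => ∃ ξ : Fin n → F, ξ ≠ 0 ∧
      ((vsupp ξ).card : ℝ) ≤ sparseRatio * n ∧ ∀ i, ξ ⬝ᵥ X i = 0) ≤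
      10 * Real.exp (-(α * n / 2 ^ 14)) := by
  have hp : IsWeight (prodWt w : (Fin n → F) → ℝ) := hw.prodWt
  have hn0 : (0 : ℝ) < n := by exact_mod_cast (by omega : 0 < n)
  set 𝒮 := univ.filter fun S : Finset (Fin n) => S.Nonempty ∧ (S.card : ℝ) ≤ sparseRatio * n
  set δ₁ : ℝ := Real.exp 1 * Real.exp (-(α * n / 2 ^ 14)) with hδ₁
  set δ₂ : ℝ := (1 + sparseRatio) ^ n * (sparseRatio⁻¹ ^ (sparseRatio * n)) ^ 2 *
    Real.exp (-(n / 2 ^ 13)) with hδ₂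
  have hε0 : 0 < sparseRatio := by unfold sparseRatio; positivity
  have hε1 : sparseRatio ≤ 1 := by unfold sparseRatio; norm_num
  have hδ₁0 : 0 ≤ δ₁ := by positivity
  have hδ₂0 : 0 ≤ δ₂ := by positivity
  have hterm : ∀ S ∈ 𝒮, mass (prodWt (prodWt w)) (fun X : Fin k → Fin n → F =>
      ∃ ξ : Fin n → F, vsupp ξ = S ∧ ∀ i, ξ ⬝ᵥ X i = 0) ≤
      (n : ℝ)⁻¹ ^ S.card * δ₁ + sparseRatio ^ S.card * δ₂ := by
    intro S hS
    obtain ⟨hSne, hSn⟩ := (Finset.mem_filter.1 hS).2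
    set s := S.card with hs
    have hs1 : (1 : ℝ) ≤ s := by exact_mod_cast hSne.card_pos
    set m : ℝ := min (α * s) 1 with hm
    have hm0 : 0 ≤ m := le_min (by positivity) zero_le_one
    set ρ : ℝ := Real.exp (-(m / 4096)) with hρ
    have h1 := mass_support_eq_le (κ := Fin k) hp hSne (ρ := ρ)
      (Real.exp_le_one_iff.2 (by linarith)) (fun ξ hξ => by
        have hξ0 : ξ ≠ 0 := by
          rintro rfl
          rw [← hξ] at hSne
          simp [vsupp] at hSne
        refine (mass_hyperplane_le hψ hw hα hα0 hξ0).trans ?_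
        have : (univ.filter fun i => ξ i ≠ 0) = S := hξ
        rw [this]
        exact half_one_add_exp_le (by positivity)) (Real.exp_pos _).le
    rw [Fintype.card_fin, ← hs] at h1
    set c : ℝ := ((univ.filter fun I : Finset (Fin k) => I.card ≤ s).card : ℝ) with hc
    have hc0 : 0 ≤ c := Nat.cast_nonneg _
    have hs4 : (s : ℝ) ≤ n / 4 := hSn.trans (by unfold sparseRatio; linarith)
    have hk4 : (3 : ℝ) * n ≤ 4 * k := by exact_mod_cast hk
    have hsk : s ≤ k := by
      have : (s : ℝ) ≤ k := by linarith
      exact_mod_cast this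
    have hpow : ρ ^ (k - s) ≤ Real.exp (-(m * n / 2 ^ 13)) := by
      rw [hρ, ← Real.exp_nat_mul, Real.exp_le_exp, Nat.cast_sub hsk]
      nlinarith
    have h2 : mass (prodWt (prodWt w)) (fun X : Fin k → Fin n → F =>
        ∃ ξ : Fin n → F, vsupp ξ = S ∧ ∀ i, ξ ⬝ᵥ X i = 0) ≤
        c * Real.exp (-(m * n / 2 ^ 13)) :=
      h1.trans (mul_le_mul_of_nonneg_left hpow hc0)
    have hcount : ∀ x : ℝ, 0 < x → x ≤ 1 → c * x ^ s ≤ (1 + x) ^ n := fun x h0 h1 => by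
      refine (card_finset_card_le s h0 h1).trans ?_
      rw [Fintype.card_fin]
      exact pow_le_pow_right₀ (by linarith) hkn
    refine h2.trans ?_
    rcases le_total (α * s) 1 with hle | hge
    · -- few subsets: each costs a power of `n`, beaten by `α n ≥ C log n`
      rw [min_eq_left hle] at hm
      have h3 := hcount (n : ℝ)⁻¹ (by positivity)
        (inv_le_one_of_one_le₀ (by exact_mod_cast (by omega : 1 ≤ n)))
      have h4 := one_add_inv_pow_le hn0
      have h5 : Real.exp (-(m * n / 2 ^ 13)) ≤
          (n : ℝ)⁻¹ ^ s * (n : ℝ)⁻¹ ^ s * Real.exp (-(α * n / 2 ^ 14)) := by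
        have h6 : (n : ℝ)⁻¹ = Real.exp (-Real.log n) := by
          rw [Real.exp_neg, Real.exp_log hn0]
        rw [h6, ← Real.exp_nat_mul, ← Real.exp_add, ← Real.exp_add, Real.exp_le_exp, hm]
        have h7 := mul_le_mul_of_nonneg_left hlog (zero_le_one.trans hs1)
        have h8 : α * n ≤ s * (α * n) := le_mul_of_one_le_left (by positivity) hs1
        linarith
      have h9 : 0 ≤ (n : ℝ)⁻¹ ^ s := by positivity
      calc c * Real.exp (-(m * n / 2 ^ 13))
          ≤ c * ((n : ℝ)⁻¹ ^ s * (n : ℝ)⁻¹ ^ s * Real.exp (-(α * n / 2 ^ 14))) :=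
            mul_le_mul_of_nonneg_left h5 hc0
        _ = (n : ℝ)⁻¹ ^ s * ((c * (n : ℝ)⁻¹ ^ s) * Real.exp (-(α * n / 2 ^ 14))) := by ring
        _ ≤ (n : ℝ)⁻¹ ^ s * (Real.exp 1 * Real.exp (-(α * n / 2 ^ 14))) := by
            gcongr; exact h3.trans h4
        _ ≤ _ := by
            have : 0 ≤ sparseRatio ^ s * δ₂ := by positivity
            rw [← hδ₁]; linarith
    · -- the probability is exponentially small in `n`, which beats the number of sparse supports
      rw [min_eq_right hge] at hm
      have h3 := hcount sparseRatio hε0 hε1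
      have h4 : (sparseRatio⁻¹) ^ s ≤ sparseRatio⁻¹ ^ (sparseRatio * n) := by
        rw [← Real.rpow_natCast]
        exact Real.rpow_le_rpow_of_exponent_le ((one_le_inv₀ hε0).2 hε1) hSn
      have h5 : c ≤ (1 + sparseRatio) ^ n * sparseRatio⁻¹ ^ s := by
        rw [inv_pow, ← div_eq_mul_inv, le_div_iff₀ (by positivity)]; exact h3
      have h6 : c ≤ sparseRatio ^ s * ((1 + sparseRatio) ^ n *
          (sparseRatio⁻¹ ^ (sparseRatio * n)) ^ 2) := by
        have h7 : sparseRatio ^ s * sparseRatio⁻¹ ^ s = 1 := by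
          rw [← mul_pow, mul_inv_cancel₀ hε0.ne', one_pow]
        calc c ≤ (1 + sparseRatio) ^ n * sparseRatio⁻¹ ^ s := h5
          _ = sparseRatio ^ s * ((1 + sparseRatio) ^ n * (sparseRatio⁻¹ ^ s) ^ 2) := by
              linear_combination (-(1 + sparseRatio) ^ n * sparseRatio⁻¹ ^ s) * h7
          _ ≤ _ := by gcongr
      calc c * Real.exp (-(m * n / 2 ^ 13))
          ≤ sparseRatio ^ s * ((1 + sparseRatio) ^ n *
          (sparseRatio⁻¹ ^ (sparseRatio * n)) ^ 2) * Real.exp (-(m * n / 2 ^ 13)) :=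
            mul_le_mul_of_nonneg_right h6 (Real.exp_pos _).le
        _ = sparseRatio ^ s * δ₂ := by rw [hδ₂, hm]; ring_nf
        _ ≤ _ := by
            have : 0 ≤ (n : ℝ)⁻¹ ^ s * δ₁ := by positivity
            linarith
  refine (hp.prodWt.mass_exists_le 𝒮 _ (fun S X => ∃ ξ : Fin n → F, vsupp ξ = S ∧
    ∀ i, ξ ⬝ᵥ X i = 0) ?_).trans ?_
  · rintro X ⟨ξ, hξ, hs, h⟩
    refine ⟨vsupp ξ, ?_, ξ, rfl, h⟩
    obtain ⟨i, hi⟩ := Function.ne_iff.1 hξ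
    simp only [𝒮, mem_filter, mem_univ, true_and]
    exact ⟨⟨i, by simpa [vsupp] using hi⟩, hs⟩
  · have hall : ∀ x : ℝ, ∑ S : Finset (Fin n), x ^ S.card = (1 + x) ^ n := fun x => by
      have := Fintype.sum_pow_mul_eq_add_pow (Fin n) x 1
      simpa [add_comm] using this
    have hE : (1 + sparseRatio) ^ n * δ₂ ≤ Real.exp (-(α * n / 2 ^ 14)) := by
      have h1 : (1 + sparseRatio) ^ n ≤ Real.exp (sparseRatio * n) := by
        rw [mul_comm, Real.exp_nat_mul]
        exact pow_le_pow_left₀ (by linarith) (by linarith [Real.add_one_le_exp sparseRatio]) n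
      have h2 : sparseRatio⁻¹ ^ (sparseRatio * n) ≤ Real.exp (14 * (sparseRatio * n)) := by
        rw [Real.rpow_def_of_pos (by positivity), Real.exp_le_exp]
        refine mul_le_mul_of_nonneg_right ?_ (by positivity)
        unfold sparseRatio
        rw [inv_inv, Real.log_pow]
        have := Real.log_two_lt_d9
        push_cast; linarith
      calc (1 + sparseRatio) ^ n * δ₂ ≤ Real.exp (sparseRatio * n) *
            (Real.exp (sparseRatio * n) * (Real.exp (14 * (sparseRatio * n))) ^ 2 *
            Real.exp (-(n / 2 ^ 13))) := by rw [hδ₂]; gcongr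
        _ = Real.exp (30 * (sparseRatio * n) - n / 2 ^ 13) := by
            rw [← Real.exp_nat_mul, ← Real.exp_add, ← Real.exp_add, ← Real.exp_add]
            congr 1; push_cast; ring
        _ ≤ _ := by
            rw [Real.exp_le_exp]
            unfold sparseRatio
            nlinarith
    have h1 := one_add_inv_pow_le hn0
    have h2 : Real.exp 1 * Real.exp 1 ≤ 8 := by
      have := Real.exp_one_lt_d9
      have := Real.exp_pos 1
      nlinarith
    calc _ ≤ ∑ S ∈ 𝒮, ((n : ℝ)⁻¹ ^ S.card * δ₁ + sparseRatio ^ S.card * δ₂) :=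
          Finset.sum_le_sum hterm
      _ ≤ ∑ S : Finset (Fin n), ((n : ℝ)⁻¹ ^ S.card * δ₁ + sparseRatio ^ S.card * δ₂) :=
          Finset.sum_le_sum_of_subset_of_nonneg (Finset.subset_univ _)
            fun _ _ _ => by positivity
      _ = (1 + (n : ℝ)⁻¹) ^ n * δ₁ + (1 + sparseRatio) ^ n * δ₂ := by
          rw [Finset.sum_add_distrib, ← Finset.sum_mul, ← Finset.sum_mul, hall, hall]
      _ ≤ Real.exp 1 * δ₁ + Real.exp (-(α * n / 2 ^ 14)) := by gcongr
      _ = (Real.exp 1 * Real.exp 1 + 1) * Real.exp (-(α * n / 2 ^ 14)) := by rw [hδ₁]; ring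
      _ ≤ _ := mul_le_mul_of_nonneg_right (by linarith) (Real.exp_pos _).le

end

/-! ### Exchanging rows with lazy rows -/

section

variable {β : Type*} [Fintype β] {p : β → ℝ}

lemma sum_prodWt_succ (p : β → ℝ) {r : ℕ} (g : (Fin (r + 1) → β) → ℝ) :
    ∑ X, prodWt p X * g X =
      ∑ Y : Fin r → β, prodWt p Y * ∑ v, p v * g (Fin.cons v Y) := by
  rw [← (Fin.consEquiv fun _ : Fin (r + 1) => β).sum_comp, Fintype.sum_prod_type, Finset.sum_comm]
  refine Finset.sum_congr rfl fun Y _ => ?_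
  rw [Finset.mul_sum]
  refine Finset.sum_congr rfl fun v _ => ?_
  have h : prodWt p (Fin.cons v Y : Fin (r + 1) → β) = p v * prodWt p Y := by
    simp [prodWt, Fin.prod_univ_succ]
  change prodWt p (Fin.cons v Y : Fin (r + 1) → β) * g (Fin.cons v Y) = _
  rw [h]; ring

end

section

variable {F : Type*} [Field F] {E : Type*} [AddCommGroup E] [Module F E] [Fintype E]

/-- Samples can be chosen independent inside `V` as long as every subspace of small dimension
has mass at most `b`. -/
lemma pow_le_mass_linearIndependent {p : E → ℝ} (hp : IsWeight p) (V : Submodule F E) {b : ℝ}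
    (hb : b ≤ mass p (fun v => v ∈ V)) (r : ℕ)
    (hU : ∀ U : Submodule F E, finrank F U ≤ r → mass p (fun v => v ∈ U) ≤ b) :
    (mass p (fun v => v ∈ V) - b) ^ r ≤
      mass (prodWt p) (fun Y : Fin r → E => LinearIndependent F Y ∧ ∀ i, Y i ∈ V) := by
  induction r with
  | zero =>
    simp [mass, prodWt]
  | succ r ih =>
    have ih' := ih fun U hUr => hU U (by omega)
    have h0 : 0 ≤ mass p (fun v => v ∈ V) - b := by linarith
    rw [pow_succ, mass_eq_sum_mul (prodWt p), sum_prodWt_succ]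
    refine (mul_le_mul_of_nonneg_right ih' h0).trans ?_
    rw [mass_eq_sum_mul (prodWt p), Finset.sum_mul]
    refine Finset.sum_le_sum fun Y _ => ?_
    rw [mul_assoc]
    refine mul_le_mul_of_nonneg_left ?_ (hp.prodWt.nonneg Y)
    by_cases hY : LinearIndependent F Y ∧ ∀ i, Y i ∈ V
    · rw [if_pos hY, one_mul]
      have h1 := hU (Submodule.span F (Set.range Y)) (by
        rw [finrank_span_eq_card hY.1]; simp)
      have h2 : mass p (fun v => v ∈ V) - b ≤ mass p (fun v => v ∈ V) -
          mass p (fun v => v ∈ Submodule.span F (Set.range Y)) := by linarith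
      refine h2.trans ?_
      · rw [mass_eq_sum_mul, mass_eq_sum_mul, ← Finset.sum_sub_distrib]
        refine Finset.sum_le_sum fun v _ => ?_
        rw [← mul_sub]
        refine mul_le_mul_of_nonneg_left ?_ (hp.nonneg v)
        by_cases hv : v ∈ V
        · by_cases hs : v ∈ Submodule.span F (Set.range Y)
          · rw [if_pos hv, if_pos hs]; split_ifs <;> norm_num
          · have h3 : LinearIndependent F (Fin.cons v Y : Fin (r + 1) → E) ∧
                ∀ i, (Fin.cons v Y : Fin (r + 1) → E) i ∈ V :=
              ⟨linearIndependent_finCons.2 ⟨hY.1, hs⟩, Fin.cases hv hY.2⟩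
            rw [if_pos hv, if_neg hs, if_pos h3]; norm_num
        · rw [if_neg hv, if_neg fun hs => hv (Submodule.span_le.2
            (by rintro _ ⟨i, rfl⟩; exact hY.2 i) hs)]
          split_ifs <;> norm_num
    · rw [if_neg hY, zero_mul]
      exact Finset.sum_nonneg fun v _ => mul_nonneg (hp.nonneg v) (by split_ifs <;> norm_num)

omit [Fintype E] in
/-- The Steinitz exchange lemma, for an independent family `Y` in the span of an independent
family `X`. -/
lemma exists_exchange [FiniteDimensional F E] {k r : ℕ} {X : Fin k → E} {Y : Fin r → E}
    (hX : LinearIndependent F X) (hY : LinearIndependent F Y)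
    (hYX : ∀ i, Y i ∈ Submodule.span F (Set.range X)) :
    ∃ I : Finset (Fin k), I.card + r = k ∧
      Submodule.span F (Set.range Y ∪ Set.range fun i : I => X i) =
        Submodule.span F (Set.range X) := by
  obtain ⟨b, hbt, hsb, htb, hli⟩ := exists_linearIndepOn_id_extension
    (hY.linearIndepOn_id) (Set.subset_union_left (t := Set.range X))
  have hfin : (Set.range Y ∪ Set.range X).Finite := (Set.finite_range Y).union (Set.finite_range X)
  let I : Finset (Fin k) := univ.filter fun i => X i ∈ b ∧ X i ∉ Set.range Y
  have hI : (Set.range fun i : I => X i) = b \ Set.range Y := by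
    ext x
    constructor
    · rintro ⟨i, rfl⟩
      exact (Finset.mem_filter.1 i.2).2
    · rintro ⟨hx, hxY⟩
      rcases hbt hx with h | ⟨i, rfl⟩
      · exact absurd h hxY
      · exact ⟨⟨i, by simp only [I, Finset.mem_filter]; exact ⟨mem_univ _, hx, hxY⟩⟩, rfl⟩
  have hb : Set.range Y ∪ (Set.range fun i : I => X i) = b := by
    rw [hI, Set.union_sdiff_cancel hsb]
  have hspan : Submodule.span F b = Submodule.span F (Set.range X) := by
    apply le_antisymm
    · refine Submodule.span_le.2 (hbt.trans (Set.union_subset ?_ Submodule.subset_span))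
      rintro _ ⟨i, rfl⟩; exact hYX i
    · exact Submodule.span_le.2 (Set.subset_union_right.trans htb)
  refine ⟨I, ?_, hb ▸ hspan⟩
  have h1 : b.ncard = k := by
    have hbf : b.Finite := hfin.subset hbt
    have : Fintype b := hbf.fintype
    have h2 := finrank_span_eq_card (R := F) (b := fun x : b => (x : E)) hli
    rw [Subtype.range_coe, hspan, finrank_span_eq_card hX, Fintype.card_fin] at h2
    rw [h2, Set.ncard_eq_toFinset_card', Set.toFinset_card]
  have h2 : (Set.range Y).ncard = r := by
    rw [← Set.image_univ, Set.ncard_image_of_injective _ hY.injective, Set.ncard_univ,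
      Nat.card_eq_fintype_card, Fintype.card_fin]
  have h3 : (Set.range fun i : I => X i).ncard = I.card := by
    have hinj : Function.Injective fun i : I => X i := hX.injective.comp Subtype.val_injective
    rw [← Set.image_univ, Set.ncard_image_of_injective _ hinj, Set.ncard_univ,
      Nat.card_eq_fintype_card, Fintype.card_coe]
  rw [hI] at h3
  have h4 := Set.ncard_sdiff_add_ncard_of_subset hsb (hfin.subset hbt)
  omega

/-- The exchange argument of Kahn, Komlós and Szemerédi. If each space `V` of a class contains
`r` independent `ν`-samples with probability at least `(M p(V)) ^ r`, replace `r` of the `k`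
independent `p`-samples spanning `V` by `ν`-samples: the remaining ones and the new ones
determine `V`, so the sum over all `V` in the class costs only the choice of the set of rows
kept. -/
lemma mass_span_class_le [FiniteDimensional F E] {p ν : E → ℝ} (hp : IsWeight p)
    (hν : IsWeight ν) {k r : ℕ}
    (𝒱 : Submodule F E → Prop) {M : ℝ} (hM : 0 < M)
    (hpos : ∀ V, 𝒱 V → 0 < mass p (fun v => v ∈ V))
    (hV : ∀ V, 𝒱 V → (M * mass p (fun v => v ∈ V)) ^ r ≤
      mass (prodWt ν) (fun Y : Fin r → E => LinearIndependent F Y ∧ ∀ i, Y i ∈ V)) :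
    mass (prodWt p) (fun X : Fin k → E => LinearIndependent F X ∧
      𝒱 (Submodule.span F (Set.range X))) ≤ 2 ^ k / M ^ r := by
  obtain ⟨W, hW⟩ : ∃ W : (I : Finset (Fin k)) → (Fin r → E) → (I → E) → Submodule F E,
      ∀ I Y Z, W I Y Z = Submodule.span F (Set.range Y ∪ Set.range Z) := ⟨_, fun _ _ _ => rfl⟩
  obtain ⟨h, hh⟩ : ∃ h : (I : Finset (Fin k)) → (Fin r → E) → (I → E) → ℝ, ∀ I Y Z, h I Y Z =
      if 𝒱 (W I Y Z) ∧ I.card + r = k then ((mass p (fun v => v ∈ W I Y Z)) ^ r)⁻¹ else 0 :=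
    ⟨_, fun _ _ _ => rfl⟩
  obtain ⟨R, hR⟩ : ∃ R : (I : Finset (Fin k)) → (Fin r → E) → (I → E) → E → Prop,
      ∀ I Y Z v, R I Y Z v ↔ v ∈ W I Y Z := ⟨_, fun _ _ _ _ => Iff.rfl⟩
  have hh0 : ∀ I Y Z, 0 ≤ h I Y Z := fun I Y Z => by
    rw [hh]; split_ifs
    · have := hp.mass_nonneg (fun v => v ∈ W I Y Z); positivity
    · exact le_rfl
  have hRmass : ∀ I Y Z, mass p (R I Y Z) = mass p (fun v => v ∈ W I Y Z) := fun I Y Z => by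
    congr 1; funext v; exact propext (hR I Y Z v)
  -- for fixed `I` and `Y`, the factor `p(V) ^ (-r)` is cancelled by the `r` free samples
  have hinner : ∀ I Y, ∑ X : Fin k → E, prodWt p X *
      (if ∀ i, i ∉ I → R I Y (fun j : I => X j) (X i) then h I Y (fun j : I => X j) else 0) ≤ 1 := by
    intro I Y
    have e := sum_prodWt_split p I (h I Y) (fun Z _ => R I Y Z)
    refine le_trans (le_of_eq (?_ : _ = ∑ Z : I → E, prodWt p Z *
      (h I Y Z * ∏ _i : {i // i ∉ I}, mass p (R I Y Z)))) ?_
    · convert e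
    calc _ ≤ ∑ Z : I → E, prodWt p Z * 1 := by
          refine Finset.sum_le_sum fun Z _ => mul_le_mul_of_nonneg_left ?_ (hp.prodWt.nonneg Z)
          rw [Finset.prod_const, Finset.card_univ, card_notMem, Fintype.card_fin, hRmass, hh]
          split_ifs with hc
          · have h1 : k - I.card = r := by omega
            have h2 := hpos _ hc.1
            rw [h1, inv_mul_cancel₀ (by positivity)]
          · simp
      _ = 1 := by rw [← Finset.sum_mul, hp.prodWt.sum_eq_one, one_mul]
  have hmain : mass (prodWt p) (fun X : Fin k → E => LinearIndependent F X ∧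
      𝒱 (Submodule.span F (Set.range X))) * M ^ r ≤
      ∑ X : Fin k → E, prodWt p X * ∑ I : Finset (Fin k), ∑ Y : Fin r → E, prodWt ν Y *
        (if ∀ i, i ∉ I → R I Y (fun j : I => X j) (X i) then h I Y (fun j : I => X j) else 0) := by
    rw [mass_eq_sum_mul, Finset.sum_mul]
    refine Finset.sum_le_sum fun X _ => ?_
    rw [mul_assoc]
    refine mul_le_mul_of_nonneg_left ?_ (hp.prodWt.nonneg X)
    have hnn : ∀ I Y, 0 ≤ prodWt ν Y * (if ∀ i, i ∉ I → R I Y (fun j : I => X j) (X i) then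
        h I Y (fun j : I => X j) else 0) := fun I Y =>
      mul_nonneg (hν.prodWt.nonneg Y) (by split_ifs; exacts [hh0 _ _ _, le_rfl])
    by_cases hX : LinearIndependent F X ∧ 𝒱 (Submodule.span F (Set.range X))
    · rw [if_pos hX, one_mul, Finset.sum_comm]
      set V := Submodule.span F (Set.range X) with hVdef
      have h1 := hpos V hX.2
      have h2 := hV V hX.2
      rw [mul_pow, ← le_div_iff₀ (by positivity), div_eq_mul_inv, mass_eq_sum_mul,
        Finset.sum_mul] at h2
      refine h2.trans (Finset.sum_le_sum fun Y _ => ?_)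
      by_cases hY : LinearIndependent F Y ∧ ∀ i, Y i ∈ V
      · obtain ⟨I, hIc, hIspan⟩ := exists_exchange hX.1 hY.1 hY.2
        have hWV : W I Y (fun j : I => X j) = V := by rw [hW]; exact hIspan
        rw [if_pos hY, mul_one]
        refine le_trans (le_of_eq ?_) (Finset.single_le_sum (fun I _ => hnn I Y)
          (Finset.mem_univ I))
        have h3 : ∀ i, i ∉ I → R I Y (fun j : I => X j) (X i) := fun i _ => by
          rw [hR, hWV]; exact Submodule.subset_span ⟨i, rfl⟩
        rw [if_pos h3, hh, hWV, if_pos ⟨hX.2, hIc⟩]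
      · rw [if_neg hY, mul_zero, zero_mul]
        exact Finset.sum_nonneg fun I _ => hnn I Y
    · rw [if_neg hX, zero_mul]
      exact Finset.sum_nonneg fun I _ => Finset.sum_nonneg fun Y _ => hnn I Y
  rw [le_div_iff₀ (by positivity)]
  refine hmain.trans ?_
  calc _ = ∑ I : Finset (Fin k), ∑ Y : Fin r → E, prodWt ν Y * ∑ X : Fin k → E, prodWt p X *
        (if ∀ i, i ∉ I → R I Y (fun j : I => X j) (X i) then h I Y (fun j : I => X j) else 0) := by
        simp only [Finset.mul_sum]
        rw [Finset.sum_comm]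
        refine Finset.sum_congr rfl fun I _ => ?_
        rw [Finset.sum_comm]
        refine Finset.sum_congr rfl fun Y _ => Finset.sum_congr rfl fun X _ => ?_
        ring
    _ ≤ ∑ I : Finset (Fin k), ∑ Y : Fin r → E, prodWt ν Y * 1 :=
        Finset.sum_le_sum fun I _ => Finset.sum_le_sum fun Y _ =>
          mul_le_mul_of_nonneg_left (hinner I Y) (hν.prodWt.nonneg Y)
    _ = 2 ^ k := by
        simp [hν.prodWt.sum_eq_one]

end

section

variable {F : Type*} [Field F] [Fintype F] {ψ : AddChar F ℂ} {w : F → ℝ} {α : ℝ}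

lemma IsDenseWeight.le_one_sub (hα : IsDenseWeight α w) (x : F) : w x ≤ 1 - α := by
  have := hα ⊥ bot_ne_top x
  simpa [mass, AddSubgroup.mem_bot, sub_eq_zero] using this

/-- The vectors orthogonal to `V` are not sparse. -/
def PerpNotSparse {n : ℕ} (V : Submodule F (Fin n → F)) : Prop :=
  ∀ ξ ∈ perp V, ξ ≠ 0 → sparseRatio * n < ((vsupp ξ).card : ℝ)

/-- With overwhelming probability independent rows do not span a space which has no sparse
normal vectors and a mass substantially larger than expected. -/
lemma mass_unsaturated_le (hψ : ψ ≠ 1) (hw : IsWeight w) (hα : IsDenseWeight α w) (hα0 : 0 < α)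
    (hα1 : α < 1) {n k : ℕ} (hn : 2 ≤ n) (hkn : k ≤ n)
    (hlarge : 2 ^ 66 ≤ α * n) :
    mass (prodWt (prodWt w)) (fun X : Fin k → Fin n → F => LinearIndependent F X ∧
      PerpNotSparse (Submodule.span F (Set.range X)) ∧
      2 * (Fintype.card (perp (Submodule.span F (Set.range X))) : ℝ)⁻¹ ≤
        mass (prodWt w) (fun v => v ∈ Submodule.span F (Set.range X)) ∧
      2 * Real.exp (-(α * n / 2 ^ 43)) ≤
        mass (prodWt w) (fun v => v ∈ Submodule.span F (Set.range X))) ≤ (2 ^ n)⁻¹ := by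
  -- level sets grow by `2 ^ 10` as the level grows by `16 ^ 10`, so that `V` has `2 ^ 8` times
  -- the mass under the lazy weight; half of this is lost to the requirement of independence
  obtain ⟨lam, hlam⟩ : ∃ lam : ℝ, lam = (16 ^ 10)⁻¹ / 4 := ⟨_, rfl⟩
  have hlam0 : 0 ≤ lam := by rw [hlam]; positivity
  have hlam1 : lam ≤ 1 / 2 := by rw [hlam]; norm_num
  have hν1 := isWeight_lazyWeight hw hlam0 (by linarith)
  have hν : IsWeight (prodWt (lazyWeight lam w) : (Fin n → F) → ℝ) := hν1.prodWt
  have hp : IsWeight (prodWt w : (Fin n → F) → ℝ) := hw.prodWt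
  have hn0 : (0 : ℝ) < n := by exact_mod_cast (by omega : 0 < n)
  set r : ℕ := n / 2 with hr
  set b : ℝ := Real.exp (-(α * n / 2 ^ 43)) with hb
  have hU : ∀ U : Submodule F (Fin n → F), finrank F U ≤ r →
      mass (prodWt (lazyWeight lam w)) (fun v => v ∈ U) ≤ b := by
    intro U hU
    have hlα : 0 ≤ lam * α := by positivity
    have hlα1 : lam * α ≤ 1 := by nlinarith
    refine (mass_submodule_le hν1 (lazyWeight_le hw hα.le_one_sub hα1.le hlam0 hlam1)
      (by linarith) U).trans ?_
    rw [Fintype.card_fin]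
    have hnr : (n : ℝ) / 2 ≤ ((n - finrank F U : ℕ) : ℝ) := by
      have : n ≤ 2 * (n - finrank F U) := by omega
      have : (n : ℝ) ≤ 2 * ((n - finrank F U : ℕ) : ℝ) := by exact_mod_cast this
      linarith
    calc (1 - lam * α) ^ (n - finrank F U)
        ≤ Real.exp (-(lam * α)) ^ (n - finrank F U) :=
          pow_le_pow_left₀ (by linarith) (by linarith [Real.add_one_le_exp (-(lam * α))]) _
      _ ≤ b := by
          rw [← Real.exp_nat_mul, hb, Real.exp_le_exp]
          have h1 := mul_le_mul_of_nonneg_right hnr hlα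
          have h2 : (n : ℝ) / 2 * (lam * α) = α * n / 2 ^ 43 := by rw [hlam]; ring
          linarith
  refine (mass_span_class_le hp hν (r := r) (M := 128) (fun V => PerpNotSparse V ∧
    2 * (Fintype.card (perp V) : ℝ)⁻¹ ≤ mass (prodWt w) (fun v => v ∈ V) ∧
    2 * b ≤ mass (prodWt w) (fun v => v ∈ V)) (by norm_num) ?_ ?_).trans ?_
  · rintro V ⟨-, -, h⟩
    have : 0 < b := Real.exp_pos _
    linarith
  · rintro V ⟨hsp, hq, hbig⟩
    have hhal := mass_le_lazyWeight hψ hw hα hα0.le V (s := sparseRatio * n)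
      (fun ξ hξ h0 => (hsp ξ hξ h0).le) (j := 10) (by norm_num) (u₀ := α * n / 2 ^ 61)
      (by positivity) (by
        have : 0 < α * n := by positivity
        unfold sparseRatio; linarith)
    rw [← hlam] at hhal
    have hexp : Real.exp (-(α * n / 2 ^ 61 / 4)) ≤ (2 ^ 10)⁻¹ := by
      have h1 : Real.exp (-(α * n / 2 ^ 61 / 4)) ≤ Real.exp (-(8 : ℝ)) := by
        rw [Real.exp_le_exp]; linarith
      have h2 : Real.exp (-(8 : ℝ)) ≤ (2 ^ 10)⁻¹ := by
        rw [Real.exp_neg]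
        apply inv_anti₀ (by norm_num)
        have h3 : Real.exp 8 = Real.exp 1 ^ 8 := by rw [← Real.exp_nat_mul]; norm_num
        rw [h3]
        have h4 : (2.7 : ℝ) ≤ Real.exp 1 := by linarith [Real.exp_one_gt_d9]
        calc (2 : ℝ) ^ 10 ≤ 2.7 ^ 8 := by norm_num
          _ ≤ _ := pow_le_pow_left₀ (by norm_num) h4 8
      exact h1.trans h2
    set m := mass (prodWt w) (fun v => v ∈ V)
    set m' := mass (prodWt (lazyWeight lam w)) (fun v => v ∈ V) with hm'
    have hm'0 : 0 ≤ m' := hν.mass_nonneg _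
    have hb0 : 0 < b := Real.exp_pos _
    have h1 : 256 * m ≤ m' := by
      have := mul_le_mul_of_nonneg_right hexp hm'0
      norm_num at this hhal
      linarith
    refine le_trans ?_ (pow_le_mass_linearIndependent hν V (b := b) (by linarith) r hU)
    exact pow_le_pow_left₀ (by linarith) (by linarith) r
  · rw [div_le_iff₀ (by positivity), inv_mul_eq_div, le_div_iff₀ (by positivity)]
    calc (2 : ℝ) ^ k * 2 ^ n ≤ 2 ^ n * 2 ^ n := by
          gcongr; norm_num
      _ = 2 ^ (2 * n) := by rw [two_mul, pow_add]
      _ ≤ 2 ^ (7 * r) := pow_le_pow_right₀ (by norm_num) (by omega)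
      _ = 128 ^ r := by rw [pow_mul]; norm_num

end

/-! ### Counting spaces with a large Fourier coefficient -/

section

variable {F : Type*} [Field F] [Fintype F] {ψ : AddChar F ℂ} {w : F → ℝ} {α : ℝ}

/-- The vectors that are not sparse and have a large Fourier coefficient. -/
noncomputable def heavyVectors (ψ : AddChar F ℂ) (w : F → ℝ) (α : ℝ) (n : ℕ) :
    Finset (Fin n → F) :=
  univ.filter fun ξ => sparseRatio * n < ((vsupp ξ).card : ℝ) ∧
    Real.exp (-(α * n / 2 ^ 66)) ≤ ∏ i, ‖charFn ψ w (ξ i)‖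

/-- Most coordinates of a heavy vector have tiny energy. The elements of `F` of tiny energy form
a small proportion of `F`, unless `0` is the only one, which would make the vector sparse. -/
lemma card_heavyVectors_le (hψ : ψ ≠ 1) (hw : IsWeight w) (hα : IsDenseWeight α w) (hα0 : 0 < α)
    (n : ℕ) :
    ((heavyVectors ψ w α n).card : ℝ) ≤ (2 * Fintype.card F) ^ n / 2 ^ (5 * n) := by
  set u : ℝ := α / 2 ^ 45 with hu
  have hu0 : 0 < u := by positivity
  have hspread : IsSpread (energy ψ w) (α * 1) := by
    have := isSpread_sum_energy (ι := Unit) hψ hw hα hα0.le (fun _ => AddMonoidHom.id F) (s := 1)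
      (fun g hg => by simp [hg])
    simpa using this
  set S := univ.filter fun x : F => energy ψ w x ≤ u with hS
  -- the number of coordinates of large energy is at most the sparsity threshold
  have hout : ∀ ξ ∈ heavyVectors ψ w α n,
      ((univ.filter fun i => ξ i ∉ S).card : ℝ) ≤ sparseRatio * n := by
    intro ξ hξ
    have h1 := (Finset.mem_filter.1 hξ).2.2.trans (prod_norm_charFn_le hw ξ)
    rw [Real.exp_le_exp] at h1
    have h2 : ((univ.filter fun i => ξ i ∉ S).card : ℝ) * u ≤ ∑ i, energy ψ w (ξ i) := by
      calc _ = ∑ i ∈ univ.filter (fun i => ξ i ∉ S), u := by rw [Finset.sum_const, nsmul_eq_mul]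
        _ ≤ ∑ i ∈ univ.filter (fun i => ξ i ∉ S), energy ψ w (ξ i) := by
            refine Finset.sum_le_sum fun i hi => ?_
            have := (Finset.mem_filter.1 hi).2
            simp only [hS, mem_filter, mem_univ, true_and, not_le] at this
            exact this.le
        _ ≤ _ := Finset.sum_le_sum_of_subset_of_nonneg (Finset.subset_univ _)
            fun i _ _ => energy_nonneg hw _
    have h3 : ((univ.filter fun i => ξ i ∉ S).card : ℝ) * u ≤ (sparseRatio * n) * u := by
      refine h2.trans ?_
      rw [hu]; unfold sparseRatio; linarith
    exact le_of_mul_le_mul_right h3 hu0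
  have hq0 : (0 : ℝ) < Fintype.card F := by exact_mod_cast Fintype.card_pos
  rcases hspread.levelCard_le hu0.le 11 (by rw [hu]; linarith) with h | h
  · have hS0 : S = {0} := by
      have h0 : (0 : F) ∈ S := by simp [hS, energy_zero, hu0.le]
      have h1 : S.card = 1 := by unfold levelCard at h; exact_mod_cast h
      obtain ⟨a, ha⟩ := Finset.card_eq_one.1 h1
      rw [ha, Finset.mem_singleton] at h0
      rw [ha, h0]
    have : heavyVectors ψ w α n = ∅ := by
      rw [Finset.eq_empty_iff_forall_notMem]
      intro ξ hξ
      have h1 := hout ξ hξ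
      have h2 := (Finset.mem_filter.1 hξ).2.1
      have h3 : (univ.filter fun i => ξ i ∉ S) = vsupp ξ := by
        unfold vsupp; rw [hS0]; simp
      rw [h3] at h1
      linarith
    rw [this, Finset.card_empty, Nat.cast_zero]
    positivity
  · -- weight the coordinates in `S` by `2 ^ 10`
    have hScard : (2 : ℝ) ^ 10 * S.card ≤ Fintype.card F := by
      have h' : (2 : ℝ) ^ 11 * S.card ≤ 2 * Fintype.card F := h
      linarith
    let g : F → ℝ := fun x => if x ∈ S then 2 ^ 10 else 1
    have hg1 : ∀ x, 1 ≤ g x := fun x => by simp only [g]; split_ifs <;> norm_num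
    have htot : ∑ ξ : Fin n → F, prodWt g ξ ≤ (2 * Fintype.card F) ^ n := by
      have h1 := sum_prodWt_mul (κ := Fin n) g (fun _ _ => 1)
      simp only [Finset.prod_const_one, mul_one, Finset.prod_const, Finset.card_univ,
        Fintype.card_fin] at h1
      rw [h1]
      have h2 : ∑ x, g x ≤ 2 * Fintype.card F := by
        calc ∑ x, g x ≤ ∑ x : F, (1 + 2 ^ 10 * (if x ∈ S then 1 else 0)) :=
              Finset.sum_le_sum fun x _ => by simp only [g]; split_ifs <;> norm_num
          _ = Fintype.card F + 2 ^ 10 * S.card := by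
              rw [Finset.sum_add_distrib, ← Finset.mul_sum, Finset.sum_boole]; simp
          _ ≤ _ := by linarith
      exact pow_le_pow_left₀ (Finset.sum_nonneg fun x _ => zero_le_one.trans (hg1 x)) h2 n
    have hlow : ∀ ξ ∈ heavyVectors ψ w α n, (2 : ℝ) ^ (5 * n) ≤ prodWt g ξ := by
      intro ξ hξ
      have h1 := hout ξ hξ
      have h2 : prodWt g ξ = (2 ^ 10) ^ (univ.filter fun i => ξ i ∈ S).card := by
        unfold prodWt
        simp only [g]
        rw [Finset.prod_ite, Finset.prod_const, Finset.prod_const, one_pow, mul_one]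
      have h3 : (univ.filter fun i => ξ i ∈ S).card + (univ.filter fun i => ξ i ∉ S).card = n := by
        rw [Finset.card_filter_add_card_filter_not]; simp
      have h4 : 2 * (univ.filter fun i => ξ i ∉ S).card ≤ n := by
        have : (2 : ℝ) * (univ.filter fun i => ξ i ∉ S).card ≤ n := by
          unfold sparseRatio at h1
          have : (0 : ℝ) ≤ n := Nat.cast_nonneg n
          linarith
        exact_mod_cast this
      rw [h2, ← pow_mul]
      exact pow_le_pow_right₀ (by norm_num) (by omega)
    rw [le_div_iff₀ (by positivity)]
    calc ((heavyVectors ψ w α n).card : ℝ) * 2 ^ (5 * n)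
        = ∑ _ξ ∈ heavyVectors ψ w α n, (2 : ℝ) ^ (5 * n) := by
          rw [Finset.sum_const, nsmul_eq_mul]
      _ ≤ ∑ ξ ∈ heavyVectors ψ w α n, prodWt g ξ := Finset.sum_le_sum hlow
      _ ≤ ∑ ξ : Fin n → F, prodWt g ξ :=
          Finset.sum_le_sum_of_subset_of_nonneg (Finset.subset_univ _) fun ξ _ _ =>
            Finset.prod_nonneg fun i _ => zero_le_one.trans (hg1 _)
      _ ≤ _ := htot

/-- A nonzero vector of a space of dimension `m + 1` has many completions to a basis: the
bases of a complementary hyperplane already suffice. -/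
lemma le_card_completions {E : Type*} [AddCommGroup E] [Module F E] [Fintype E] {m : ℕ}
    (hE : finrank F E = m + 1) {ξ : E} (hξ : ξ ≠ 0) :
    (((Fintype.card F : ℝ) ^ m) / 2) ^ m ≤ ((univ.filter fun Y : Fin m → E =>
      LinearIndependent F (Fin.cons ξ Y : Fin (m + 1) → E)).card : ℝ) := by
  obtain ⟨C, hC⟩ := Submodule.exists_isCompl (Submodule.span F {ξ})
  have hCrank : finrank F C = m := by
    have := Submodule.finrank_add_eq_of_isCompl hC
    rw [finrank_span_singleton hξ, hE] at this
    omega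
  have hq : 2 ≤ Fintype.card F := Fintype.one_lt_card
  have hcount := card_linearIndependent (K := F) (V := C) (k := m) hCrank.ge
  have h1 : Nat.card {s : Fin m → C // LinearIndependent F s} ≤ (univ.filter fun Y : Fin m → E =>
      LinearIndependent F (Fin.cons ξ Y : Fin (m + 1) → E)).card := by
    rw [Nat.card_eq_fintype_card, Fintype.card_subtype]
    refine Finset.card_le_card_of_injOn (fun s i => (s i : E)) (fun s hs => ?_)
      fun s _ t _ hst => funext fun i => Subtype.ext (congrFun hst i)
    have hs' : LinearIndependent F s := (Finset.mem_filter.1 hs).2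
    refine Finset.mem_filter.2 ⟨mem_univ _, linearIndependent_finCons.2
      ⟨hs'.map' C.subtype C.ker_subtype, fun hmem => hξ ?_⟩⟩
    have h2 : Submodule.span F (Set.range fun i => (s i : E)) ≤ C := by
      rw [Submodule.span_le]; rintro _ ⟨i, rfl⟩; exact (s i).2
    exact (Submodule.disjoint_def.1 hC.disjoint) _ (Submodule.mem_span_singleton_self _) (h2 hmem)
  have h2 : (((Fintype.card F : ℝ) ^ m) / 2) ^ m ≤
      (Nat.card {s : Fin m → C // LinearIndependent F s} : ℝ) := by
    rw [hcount, hCrank]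
    push_cast
    calc (((Fintype.card F : ℝ) ^ m) / 2) ^ m = ∏ _i : Fin m, ((Fintype.card F : ℝ) ^ m) / 2 := by
          rw [Finset.prod_const, Finset.card_univ, Fintype.card_fin]
      _ ≤ _ := by
          refine Finset.prod_le_prod (fun i _ => by positivity) fun i _ => ?_
          have h3 : 2 * Fintype.card F ^ (i : ℕ) ≤ Fintype.card F ^ m :=
            calc 2 * Fintype.card F ^ (i : ℕ) ≤ Fintype.card F * Fintype.card F ^ (i : ℕ) :=
                  Nat.mul_le_mul_right _ hq
              _ = Fintype.card F ^ (i + 1 : ℕ) := by rw [pow_succ, mul_comm]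
              _ ≤ _ := Nat.pow_le_pow_right (by omega) i.2
          rw [Nat.cast_sub (by omega)]
          have h4 : (2 : ℝ) * (Fintype.card F : ℝ) ^ (i : ℕ) ≤ (Fintype.card F : ℝ) ^ m := by
            exact_mod_cast h3
          push_cast
          linarith
  exact h2.trans (by exact_mod_cast h1)

lemma le_card_completions_submodule {n m : ℕ} (G : Submodule F (Fin n → F))
    (hG : finrank F G = m + 1) {ξ : Fin n → F} (hξG : ξ ∈ G) (hξ : ξ ≠ 0) :
    (((Fintype.card F : ℝ) ^ m) / 2) ^ m ≤ ((univ.filter fun Y : Fin m → Fin n → F =>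
      LinearIndependent F (Fin.cons ξ Y : Fin (m + 1) → Fin n → F) ∧ ∀ i, Y i ∈ G).card : ℝ) := by
  refine (le_card_completions hG (ξ := ⟨ξ, hξG⟩) fun h => hξ (congrArg Subtype.val h)).trans ?_
  rw [Nat.cast_le]
  refine Finset.card_le_card_of_injOn (fun Y i => (Y i : Fin n → F)) (fun Y hY => ?_)
    fun s _ t _ hst => funext fun i => Subtype.ext (congrFun hst i)
  refine Finset.mem_filter.2 ⟨mem_univ _, ?_, fun i => (Y i).2⟩
  have h1 := ((Finset.mem_filter.1 hY).2).map' G.subtype G.ker_subtype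
  have h2 : (Fin.cons ξ fun i => (Y i : Fin n → F) : Fin (m + 1) → Fin n → F) =
      G.subtype ∘ (Fin.cons (⟨ξ, hξG⟩ : G) Y : Fin (m + 1) → G) := by
    funext i
    refine Fin.cases ?_ (fun j => ?_) i <;> rfl
  rw [h2]
  exact h1

/-- A union bound over the pairs of a heavy vector `ξ` and a completion of it to a basis of the
space orthogonal to the rows. Such a pair determines the span of the rows, which has mass at
most `2 q ^ (-(m + 1))`, and every space arises from many pairs. -/
lemma mass_heavy_le (hw : IsWeight w) {n k m : ℕ} (hkm : k + (m + 1) = n) :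
    mass (prodWt (prodWt w)) (fun X : Fin k → Fin n → F => LinearIndependent F X ∧
      mass (prodWt w) (fun v => v ∈ Submodule.span F (Set.range X)) ≤
        2 * ((Fintype.card F : ℝ) ^ (m + 1))⁻¹ ∧
      ∃ ξ ∈ heavyVectors ψ w α n, ξ ≠ 0 ∧ ξ ∈ perp (Submodule.span F (Set.range X))) ≤
      2 ^ n * (Fintype.card F : ℝ) ^ (2 * m + 1) / (Fintype.card F : ℝ) ^ n *
        (heavyVectors ψ w α n).card := by
  set q : ℝ := (Fintype.card F : ℝ) with hq
  have hq0 : 0 < q := by rw [hq]; exact_mod_cast Fintype.card_pos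
  have hp : IsWeight (prodWt w : (Fin n → F) → ℝ) := hw.prodWt
  set B := heavyVectors ψ w α n
  obtain ⟨U, hU⟩ : ∃ U : (Fin n → F) → (Fin m → Fin n → F) → Submodule F (Fin n → F),
      ∀ ξ Y, U ξ Y = perp (Submodule.span F
        (Set.range (Fin.cons ξ Y : Fin (m + 1) → Fin n → F))) := ⟨_, fun _ _ => rfl⟩
  have hterm : ∀ ξ Y, mass (prodWt (prodWt w)) (fun X : Fin k → Fin n → F =>
      mass (prodWt w) (fun v => v ∈ U ξ Y) ≤ 2 * (q ^ (m + 1))⁻¹ ∧ ∀ i, X i ∈ U ξ Y) ≤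
      (2 * (q ^ (m + 1))⁻¹) ^ k := by
    intro ξ Y
    by_cases h : mass (prodWt w) (fun v => v ∈ U ξ Y) ≤ 2 * (q ^ (m + 1))⁻¹
    · refine (hp.prodWt.mass_mono (R := fun X => ∀ i, X i ∈ U ξ Y) fun X hX => hX.2).trans ?_
      have := mass_prodWt_forall (κ := Fin k) (prodWt w) (fun _ v => v ∈ U ξ Y)
      rw [this, Finset.prod_const, Finset.card_univ, Fintype.card_fin]
      exact pow_le_pow_left₀ (hp.mass_nonneg _) h k
    · refine le_trans (le_of_eq (Finset.sum_eq_zero fun X _ => if_neg fun hX => h hX.1)) ?_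
      positivity
  have hmain : mass (prodWt (prodWt w)) (fun X : Fin k → Fin n → F => LinearIndependent F X ∧
      mass (prodWt w) (fun v => v ∈ Submodule.span F (Set.range X)) ≤ 2 * (q ^ (m + 1))⁻¹ ∧
      ∃ ξ ∈ B, ξ ≠ 0 ∧ ξ ∈ perp (Submodule.span F (Set.range X))) * (q ^ m / 2) ^ m ≤
      ∑ ξ ∈ B, ∑ Y : Fin m → Fin n → F, mass (prodWt (prodWt w)) (fun X : Fin k → Fin n → F =>
      mass (prodWt w) (fun v => v ∈ U ξ Y) ≤ 2 * (q ^ (m + 1))⁻¹ ∧ ∀ i, X i ∈ U ξ Y) := by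
    simp only [mass_eq_sum_mul (prodWt (prodWt w) : (Fin k → Fin n → F) → ℝ)]
    rw [Finset.sum_mul, Finset.sum_congr rfl fun ξ _ => Finset.sum_comm, Finset.sum_comm]
    refine Finset.sum_le_sum fun X _ => ?_
    simp only [← Finset.mul_sum]
    rw [mul_assoc]
    refine mul_le_mul_of_nonneg_left ?_ (hp.prodWt.nonneg X)
    set V := Submodule.span F (Set.range X) with hV
    by_cases hX : LinearIndependent F X ∧ mass (prodWt w) (fun v => v ∈ V) ≤
        2 * (q ^ (m + 1))⁻¹ ∧ ∃ ξ ∈ B, ξ ≠ 0 ∧ ξ ∈ perp V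
    · rw [if_pos hX, one_mul]
      obtain ⟨hli, hmass, ξ, hξB, hξ0, hξV⟩ := hX
      have hVrank : finrank F V = k := by rw [hV, finrank_span_eq_card hli, Fintype.card_fin]
      have hPrank : finrank F (perp V) = m + 1 := by
        rw [finrank_perp V, hVrank, Fintype.card_fin]; omega
      refine (le_card_completions_submodule (perp V) hPrank hξV hξ0).trans ?_
      refine le_trans ?_ (Finset.single_le_sum (fun ξ _ => Finset.sum_nonneg fun Y _ => ?_) hξB)
      · rw [Finset.card_filter]
        push_cast
        refine Finset.sum_le_sum fun Y _ => ?_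
        by_cases hY : LinearIndependent F (Fin.cons ξ Y : Fin (m + 1) → Fin n → F) ∧
            ∀ i, Y i ∈ perp V
        · have hle : V ≤ U ξ Y := by
            intro v hv
            rw [hU, mem_perp_span]
            intro i
            rw [dotProduct_comm]
            refine Fin.cases ?_ (fun j => ?_) i
            · exact hξV v hv
            · exact hY.2 j v hv
          have hUV : V = U ξ Y := by
            refine Submodule.eq_of_le_of_finrank_eq hle ?_
            rw [hU, finrank_perp _, finrank_span_eq_card hY.1, hVrank, Fintype.card_fin,
              Fintype.card_fin]
            omega
          rw [if_pos hY, if_pos]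
          rw [← hUV]
          exact ⟨hmass, fun i => Submodule.subset_span ⟨i, rfl⟩⟩
        · rw [if_neg hY]; split_ifs <;> norm_num
      · split_ifs <;> norm_num
    · rw [if_neg hX, zero_mul]
      exact Finset.sum_nonneg fun ξ _ => Finset.sum_nonneg fun Y _ => by split_ifs <;> norm_num
  have hbound : mass (prodWt (prodWt w)) (fun X : Fin k → Fin n → F => LinearIndependent F X ∧
      mass (prodWt w) (fun v => v ∈ Submodule.span F (Set.range X)) ≤ 2 * (q ^ (m + 1))⁻¹ ∧
      ∃ ξ ∈ B, ξ ≠ 0 ∧ ξ ∈ perp (Submodule.span F (Set.range X))) * (q ^ m / 2) ^ m ≤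
      B.card * (q ^ (n * m) * (2 * (q ^ (m + 1))⁻¹) ^ k) := by
    refine hmain.trans ?_
    calc _ ≤ ∑ ξ ∈ B, ∑ Y : Fin m → Fin n → F, (2 * (q ^ (m + 1))⁻¹) ^ k :=
          Finset.sum_le_sum fun ξ _ => Finset.sum_le_sum fun Y _ => hterm ξ Y
      _ = _ := by
          simp only [Finset.sum_const, nsmul_eq_mul, Finset.card_univ, Fintype.card_pi,
            Finset.prod_const, Fintype.card_fin]
          push_cast
          rw [pow_mul]
  rw [← le_div_iff₀ (by positivity)] at hbound
  refine hbound.trans ?_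
  have h2 : (2 : ℝ) ^ (m + k) ≤ 2 ^ n := pow_le_pow_right₀ (by norm_num) (by omega)
  have hexp : n * m + (n : ℕ) = 2 * m + 1 + (m + 1) * k + m * m := by
    subst hkm; ring
  have heq : (B.card : ℝ) * (q ^ (n * m) * (2 * (q ^ (m + 1))⁻¹) ^ k) / (q ^ m / 2) ^ m =
      2 ^ (m + k) * q ^ (2 * m + 1) / q ^ n * B.card := by
    rw [mul_pow, div_pow, inv_pow, ← pow_mul, ← pow_mul, pow_add]
    field_simp
    have h3 : q ^ (n * m) * q ^ n = q ^ (2 * m + 1) * q ^ ((m + 1) * k) * q ^ (m * m) := by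
      rw [← pow_add, ← pow_add, ← pow_add, hexp]
    linear_combination (B.card : ℝ) * h3
  rw [heq]
  gcongr

end

/-! ### Adding one row at a time -/

lemma two_pow_inv_le (n : ℕ) : ((2 : ℝ) ^ n)⁻¹ ≤ Real.exp (-(n / 2)) := by
  rw [Real.exp_neg]
  refine inv_anti₀ (Real.exp_pos _) ?_
  have h : Real.exp (1 / 2) ≤ 2 := by
    rw [← Real.le_log_iff_exp_le (by norm_num)]
    linarith [Real.log_two_gt_d9]
  calc Real.exp (n / 2) = Real.exp (1 / 2) ^ n := by rw [← Real.exp_nat_mul]; ring_nf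
    _ ≤ 2 ^ n := pow_le_pow_left₀ (Real.exp_pos _).le h n

section

variable {F : Type*} [Field F] [Fintype F] {ψ : AddChar F ℂ} {w : F → ℝ} {α : ℝ}

/-- The expected deviation of the mass of the span of `k` independent rows from its value under
the uniform weight. -/
noncomputable def spanDeviation (w : F → ℝ) (n k : ℕ) : ℝ :=
  ∑ X : Fin k → Fin n → F, prodWt (prodWt w) X * (if LinearIndependent F X then
    |mass (prodWt w) (fun v => v ∈ Submodule.span F (Set.range X)) -
      ((Fintype.card F : ℝ) ^ (n - k))⁻¹| else 0)

lemma card_perp_span {n k : ℕ} {X : Fin k → Fin n → F} (hX : LinearIndependent F X) :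
    (Fintype.card (perp (Submodule.span F (Set.range X))) : ℝ) =
      (Fintype.card F : ℝ) ^ (n - k) := by
  rw [card_perp, finrank_span_eq_card hX, Fintype.card_fin, Fintype.card_fin]

lemma abs_sub_le_one_of_mem {a b : ℝ} (ha0 : 0 ≤ a) (ha1 : a ≤ 1) (hb0 : 0 ≤ b) (hb1 : b ≤ 1) :
    |a - b| ≤ 1 := by
  rw [abs_le]; constructor <;> linarith

/-- For few rows the mass of the span and its uniform value are both exponentially small. -/
lemma spanDeviation_le_of_few_rows (hw : IsWeight w) (hα : IsDenseWeight α w) (hα0 : 0 < α)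
    (hα1 : α < 1) {n k : ℕ} (hk : 4 * k < 3 * n) :
    spanDeviation w n k ≤ 2 * Real.exp (-(α * n / 8)) := by
  have hp : IsWeight (prodWt w : (Fin n → F) → ℝ) := hw.prodWt
  have hnk : (n : ℝ) / 4 ≤ ((n - k : ℕ) : ℝ) := by
    have : n ≤ 4 * (n - k) := by omega
    have : (n : ℝ) ≤ 4 * ((n - k : ℕ) : ℝ) := by exact_mod_cast this
    linarith
  have hn0 : (0 : ℝ) ≤ n := Nat.cast_nonneg n
  calc spanDeviation w n k ≤ ∑ X : Fin k → Fin n → F, prodWt (prodWt w) X *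
        (2 * Real.exp (-(α * n / 8))) := by
        refine Finset.sum_le_sum fun X _ => mul_le_mul_of_nonneg_left ?_ (hp.prodWt.nonneg X)
        split_ifs with hX
        · have h1 : mass (prodWt w) (fun v => v ∈ Submodule.span F (Set.range X)) ≤
              Real.exp (-(α * n / 8)) := by
            refine (mass_submodule_le hw hα.le_one_sub (by linarith) _).trans ?_
            rw [finrank_span_eq_card hX, Fintype.card_fin, Fintype.card_fin]
            calc (1 - α) ^ (n - k) ≤ Real.exp (-α) ^ (n - k) :=
                  pow_le_pow_left₀ (by linarith) (by linarith [Real.add_one_le_exp (-α)]) _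
              _ ≤ _ := by
                  rw [← Real.exp_nat_mul, Real.exp_le_exp]
                  nlinarith
          have h2 : ((Fintype.card F : ℝ) ^ (n - k))⁻¹ ≤ Real.exp (-(α * n / 8)) := by
            have hq : (2 : ℝ) ≤ Fintype.card F := by exact_mod_cast Fintype.one_lt_card (α := F)
            calc ((Fintype.card F : ℝ) ^ (n - k))⁻¹ ≤ ((2 : ℝ) ^ (n - k))⁻¹ := by gcongr
              _ ≤ Real.exp (-((n - k : ℕ) / 2)) := two_pow_inv_le _
              _ ≤ _ := by rw [Real.exp_le_exp]; nlinarith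
          have h3 := hp.mass_nonneg fun v => v ∈ Submodule.span F (Set.range X)
          have h4 : 0 ≤ ((Fintype.card F : ℝ) ^ (n - k))⁻¹ := by positivity
          rw [abs_le]; constructor <;> linarith
        · positivity
    _ = _ := by rw [← Finset.sum_mul, hp.prodWt.sum_eq_one, one_mul]

/-- For many rows the deviation is exponentially small unless there is a sparse normal vector,
or the span is too heavy, or there is a heavy normal vector. -/
lemma spanDeviation_le_of_many_rows (hψ : ψ ≠ 1) (hw : IsWeight w) (hα : IsDenseWeight α w)
    (hα0 : 0 < α) (hα1 : α < 1) {n k : ℕ} (hn : 2 ≤ n) (hk : 3 * n ≤ 4 * k) (hkn : k < n)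
    (hlog : 2 ^ 15 * Real.log n ≤ α * n) (hlarge : 2 ^ 66 ≤ α * n) :
    spanDeviation w n k ≤ 15 * Real.exp (-(α * n / 2 ^ 66)) := by
  have hp : IsWeight (prodWt w : (Fin n → F) → ℝ) := hw.prodWt
  set t : ℝ := Real.exp (-(α * n / 2 ^ 66)) with ht
  set b : ℝ := Real.exp (-(α * n / 2 ^ 43)) with hb
  have hαn : 0 ≤ α * n := by positivity
  have hαn1 : α * n ≤ n := by
    have : (0 : ℝ) ≤ n := Nat.cast_nonneg n
    nlinarith
  have hbt : b ≤ t := by rw [hb, ht, Real.exp_le_exp]; linarith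
  have ht0 : 0 < t := Real.exp_pos _
  have htwo : ((2 : ℝ) ^ n)⁻¹ ≤ t :=
    (two_pow_inv_le n).trans (by rw [ht, Real.exp_le_exp]; linarith)
  have hq1 : (1 : ℝ) ≤ Fintype.card F := by exact_mod_cast Fintype.card_pos
  obtain ⟨m, hm⟩ : ∃ m, k + (m + 1) = n := ⟨n - k - 1, by omega⟩
  have hnk : n - k = m + 1 := by omega
  obtain ⟨Q₁, hQ₁⟩ : ∃ Q₁ : (Fin k → Fin n → F) → Prop, Q₁ = fun X =>
      ∃ ξ : Fin n → F, ξ ≠ 0 ∧ ((vsupp ξ).card : ℝ) ≤ sparseRatio * n ∧ ∀ i, ξ ⬝ᵥ X i = 0 :=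
    ⟨_, rfl⟩
  obtain ⟨Q₂, hQ₂⟩ : ∃ Q₂ : (Fin k → Fin n → F) → Prop, Q₂ = fun X => LinearIndependent F X ∧
      PerpNotSparse (Submodule.span F (Set.range X)) ∧
      2 * (Fintype.card (perp (Submodule.span F (Set.range X))) : ℝ)⁻¹ ≤
        mass (prodWt w) (fun v => v ∈ Submodule.span F (Set.range X)) ∧
      2 * Real.exp (-(α * n / 2 ^ 43)) ≤
        mass (prodWt w) (fun v => v ∈ Submodule.span F (Set.range X)) := ⟨_, rfl⟩
  obtain ⟨Q₃, hQ₃⟩ : ∃ Q₃ : (Fin k → Fin n → F) → Prop, Q₃ = fun X =>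
      b < ((Fintype.card F : ℝ) ^ (m + 1))⁻¹ ∧ (LinearIndependent F X ∧
      mass (prodWt w) (fun v => v ∈ Submodule.span F (Set.range X)) ≤
        2 * ((Fintype.card F : ℝ) ^ (m + 1))⁻¹ ∧
      ∃ ξ ∈ heavyVectors ψ w α n, ξ ≠ 0 ∧ ξ ∈ perp (Submodule.span F (Set.range X))) := ⟨_, rfl⟩
  have h1 : mass (prodWt (prodWt w)) Q₁ ≤ 10 * t := by
    rw [hQ₁]
    refine (mass_sparse_le hψ hw hα hα0 hα1 hn hk hkn.le hlog).trans ?_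
    refine mul_le_mul_of_nonneg_left ?_ (by norm_num)
    rw [ht, Real.exp_le_exp]; linarith
  have h2 : mass (prodWt (prodWt w)) Q₂ ≤ t := by
    rw [hQ₂]
    exact (mass_unsaturated_le hψ hw hα hα0 hα1 hn hkn.le hlarge).trans htwo
  have h3 : mass (prodWt (prodWt w)) Q₃ ≤ t := by
    by_cases hbq : b < ((Fintype.card F : ℝ) ^ (m + 1))⁻¹
    · refine le_trans ?_ htwo
      refine (hp.prodWt.mass_mono fun X hX => ?_).trans
        ((mass_heavy_le (ψ := ψ) (α := α) hw hm).trans ?_)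
      · rw [hQ₃] at hX; exact hX.2
      have hheavy := card_heavyVectors_le hψ hw hα hα0 n
      set q : ℝ := (Fintype.card F : ℝ)
      have hq0 : 0 < q := by linarith
      have hqm : q ^ (m + 1) ≤ 2 ^ n := by
        have h4 : q ^ (m + 1) ≤ Real.exp (α * n / 2 ^ 43) := by
          rw [hb, Real.exp_neg] at hbq
          exact ((inv_lt_inv₀ (Real.exp_pos _) (by positivity)).1 hbq).le
        have h5 := inv_anti₀ (by positivity) (two_pow_inv_le n)
        rw [Real.exp_neg, inv_inv, inv_inv] at h5
        refine h4.trans (le_trans ?_ h5)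
        rw [Real.exp_le_exp]; linarith
      have hqm2 : q ^ (2 * m + 1) ≤ (2 ^ n) ^ 2 :=
        calc q ^ (2 * m + 1) ≤ q ^ ((m + 1) * 2) := pow_le_pow_right₀ hq1 (by omega)
          _ = (q ^ (m + 1)) ^ 2 := pow_mul _ _ _
          _ ≤ _ := by gcongr
      calc _ ≤ 2 ^ n * (2 ^ n) ^ 2 / q ^ n * ((2 * q) ^ n / 2 ^ (5 * n)) := by gcongr
        _ = (2 ^ n)⁻¹ := by
            rw [mul_pow, mul_comm 5 n, pow_mul]
            field_simp
    · refine le_trans (le_of_eq (Finset.sum_eq_zero fun X _ => if_neg fun hX => ?_)) ht0.le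
      rw [hQ₃] at hX
      exact hbq hX.1
  have hpoint : ∀ X : Fin k → Fin n → F, (if LinearIndependent F X then
      |mass (prodWt w) (fun v => v ∈ Submodule.span F (Set.range X)) -
        ((Fintype.card F : ℝ) ^ (n - k))⁻¹| else 0) ≤
      (if Q₁ X then 1 else 0) + (if Q₂ X then 1 else 0) + (if Q₃ X then 1 else 0) + 2 * t := by
    intro X
    have e1 : (0 : ℝ) ≤ if Q₁ X then 1 else 0 := by split_ifs <;> norm_num
    have e2 : (0 : ℝ) ≤ if Q₂ X then 1 else 0 := by split_ifs <;> norm_num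
    have e3 : (0 : ℝ) ≤ if Q₃ X then 1 else 0 := by split_ifs <;> norm_num
    by_cases hX : LinearIndependent F X
    swap
    · rw [if_neg hX]; linarith
    rw [if_pos hX]
    have hD := card_perp_span (n := n) hX
    rw [hnk] at hD ⊢
    have hm0 := hp.mass_nonneg fun v => v ∈ Submodule.span F (Set.range X)
    have hm1 := hp.mass_le_one fun v => v ∈ Submodule.span F (Set.range X)
    have hD0 : 0 < ((Fintype.card F : ℝ) ^ (m + 1))⁻¹ := by positivity
    have hD1 : ((Fintype.card F : ℝ) ^ (m + 1))⁻¹ ≤ 1 :=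
      inv_le_one_of_one_le₀ (one_le_pow₀ hq1)
    have hle1 := abs_sub_le_one_of_mem hm0 hm1 hD0.le hD1
    by_cases hq₁ : Q₁ X
    · rw [if_pos hq₁]; linarith
    by_cases hq₂ : Q₂ X
    · rw [if_pos hq₂]; linarith
    by_cases hq₃ : Q₃ X
    · rw [if_pos hq₃]; linarith
    have hns : PerpNotSparse (Submodule.span F (Set.range X)) := by
      intro ξ hξ h0
      by_contra hcon
      exact hq₁ (hQ₁ ▸ ⟨ξ, h0, not_lt.1 hcon, mem_perp_span.1 hξ⟩)
    set V := Submodule.span F (Set.range X)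
    have hsmall : |mass (prodWt w) (fun v => v ∈ V) - ((Fintype.card F : ℝ) ^ (m + 1))⁻¹| ≤
        2 * t := by
      rcases le_or_gt ((Fintype.card F : ℝ) ^ (m + 1))⁻¹ b with hbD | hbD
      · have h4 : mass (prodWt w) (fun v => v ∈ V) < 2 * b := by
          by_contra hcon
          push Not at hcon
          exact hq₂ (hQ₂ ▸ ⟨hX, hns, by rw [hD]; linarith, hcon⟩)
        rw [abs_le]; constructor <;> linarith
      · have h4 : mass (prodWt w) (fun v => v ∈ V) ≤ 2 * ((Fintype.card F : ℝ) ^ (m + 1))⁻¹ := by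
          by_contra hcon
          push Not at hcon
          exact hq₂ (hQ₂ ▸ ⟨hX, hns, by rw [hD]; linarith, by linarith⟩)
        rw [← hD]
        refine (abs_mass_sub_le_of_forall hψ hw V ht0.le fun ξ hξ h0 => ?_).trans (by linarith)
        by_contra hcon
        push Not at hcon
        have hh : ξ ∈ heavyVectors ψ w α n :=
          Finset.mem_filter.2 ⟨mem_univ _, hns ξ hξ h0, hcon.le⟩
        exact hq₃ (hQ₃ ▸ ⟨hbD, hX, h4, ξ, hh, h0, hξ⟩)
    linarith
  calc spanDeviation w n k
      ≤ ∑ X : Fin k → Fin n → F, prodWt (prodWt w) X * ((if Q₁ X then 1 else 0) +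
        (if Q₂ X then 1 else 0) + (if Q₃ X then 1 else 0) + 2 * t) :=
        Finset.sum_le_sum fun X _ => mul_le_mul_of_nonneg_left (hpoint X) (hp.prodWt.nonneg X)
    _ = mass (prodWt (prodWt w)) Q₁ + mass (prodWt (prodWt w)) Q₂ +
        mass (prodWt (prodWt w)) Q₃ + 2 * t := by
        simp only [mul_add, Finset.sum_add_distrib, ← mass_eq_sum_mul, ← Finset.sum_mul,
          hp.prodWt.sum_eq_one, one_mul]
    _ ≤ _ := by linarith

lemma spanDeviation_le (hψ : ψ ≠ 1) (hw : IsWeight w) (hα : IsDenseWeight α w)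
    (hα0 : 0 < α) (hα1 : α < 1) {n k : ℕ} (hn : 2 ≤ n) (hkn : k < n)
    (hlog : 2 ^ 15 * Real.log n ≤ α * n) (hlarge : 2 ^ 66 ≤ α * n) :
    spanDeviation w n k ≤ 15 * Real.exp (-(α * n / 2 ^ 66)) := by
  rcases Nat.lt_or_ge (4 * k) (3 * n) with hk | hk
  · refine (spanDeviation_le_of_few_rows hw hα hα0 hα1 hk).trans ?_
    have : 0 ≤ α * n := by positivity
    have h1 : Real.exp (-(α * n / 8)) ≤ Real.exp (-(α * n / 2 ^ 66)) := by
      rw [Real.exp_le_exp]; linarith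
    have h2 := Real.exp_pos (-(α * n / 2 ^ 66))
    linarith
  · exact spanDeviation_le_of_many_rows hψ hw hα hα0 hα1 hn hk hkn hlog hlarge

/-- The probability that `k` rows are linearly independent. -/
noncomputable def indepProb (w : F → ℝ) (n k : ℕ) : ℝ :=
  mass (prodWt (prodWt w)) (fun X : Fin k → Fin n → F => LinearIndependent F X)

lemma abs_indepProb_succ_sub_le (hw : IsWeight w) (n k : ℕ) :
    |indepProb w n (k + 1) - indepProb w n k * (1 - ((Fintype.card F : ℝ) ^ (n - k))⁻¹)| ≤
      spanDeviation w n k := by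
  have hp : IsWeight (prodWt w : (Fin n → F) → ℝ) := hw.prodWt
  have h1 : indepProb w n (k + 1) = ∑ X : Fin k → Fin n → F, prodWt (prodWt w) X *
      (if LinearIndependent F X then
        1 - mass (prodWt w) (fun v => v ∈ Submodule.span F (Set.range X)) else 0) := by
    rw [indepProb, mass_eq_sum_mul, sum_prodWt_succ]
    refine Finset.sum_congr rfl fun X _ => ?_
    congr 1
    by_cases hX : LinearIndependent F X
    · rw [if_pos hX, ← hp.mass_not, mass_eq_sum_mul]
      refine Finset.sum_congr rfl fun v _ => ?_
      by_cases hv : v ∈ Submodule.span F (Set.range X) <;>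
        simp [linearIndependent_finCons, hX, hv]
    · rw [if_neg hX]
      exact Finset.sum_eq_zero fun v _ => by simp [linearIndependent_finCons, hX]
  have h2 : indepProb w n (k + 1) -
      indepProb w n k * (1 - ((Fintype.card F : ℝ) ^ (n - k))⁻¹) =
      ∑ X : Fin k → Fin n → F, prodWt (prodWt w) X * (if LinearIndependent F X then
        -(mass (prodWt w) (fun v => v ∈ Submodule.span F (Set.range X)) -
          ((Fintype.card F : ℝ) ^ (n - k))⁻¹) else 0) := by
    rw [h1, indepProb, mass_eq_sum_mul, Finset.sum_mul, ← Finset.sum_sub_distrib]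
    refine Finset.sum_congr rfl fun X _ => ?_
    split_ifs <;> ring
  rw [h2, spanDeviation]
  refine (Finset.abs_sum_le_sum_abs _ _).trans (Finset.sum_le_sum fun X _ => ?_)
  rw [abs_mul, abs_of_nonneg (hp.prodWt.nonneg X)]
  refine mul_le_mul_of_nonneg_left ?_ (hp.prodWt.nonneg X)
  split_ifs
  · rw [abs_neg]
  · simp

/-- Given `k` independent rows, the next one is independent of them with probability one minus
the mass of their span, so the errors of the single steps add up. -/
lemma abs_indepProb_sub_prod_le (hψ : ψ ≠ 1) (hw : IsWeight w) (hα : IsDenseWeight α w)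
    (hα0 : 0 < α) (hα1 : α < 1) {n : ℕ} (hn : 2 ≤ n)
    (hlog : 2 ^ 15 * Real.log n ≤ α * n) (hlarge : 2 ^ 66 ≤ α * n) :
    |indepProb w n n - ∏ i ∈ range n, (1 - ((Fintype.card F : ℝ) ^ (i + 1))⁻¹)| ≤
      n * (15 * Real.exp (-(α * n / 2 ^ 66))) := by
  have hq1 : (1 : ℝ) ≤ Fintype.card F := by exact_mod_cast Fintype.card_pos
  have key : ∀ k, k ≤ n →
      |indepProb w n k - ∏ i ∈ range k, (1 - ((Fintype.card F : ℝ) ^ (n - i))⁻¹)| ≤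
      k * (15 * Real.exp (-(α * n / 2 ^ 66))) := by
    intro k
    induction k with
    | zero => intro _; simp [indepProb, mass, prodWt]
    | succ k ih =>
      intro hk
      have h1 := ih (by omega)
      have h2 := (abs_indepProb_succ_sub_le hw n k).trans
        (spanDeviation_le hψ hw hα hα0 hα1 hn (by omega : k < n) hlog hlarge)
      rw [Finset.prod_range_succ]
      set a := 1 - ((Fintype.card F : ℝ) ^ (n - k))⁻¹ with ha
      have ha0 : 0 ≤ a := by
        have := inv_le_one_of_one_le₀ (one_le_pow₀ hq1 (n := n - k))
        linarith
      have ha1 : a ≤ 1 := by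
        have : 0 ≤ ((Fintype.card F : ℝ) ^ (n - k))⁻¹ := by positivity
        linarith
      have h3 : |(indepProb w n k - ∏ i ∈ range k, (1 - ((Fintype.card F : ℝ) ^ (n - i))⁻¹)) * a| ≤
          k * (15 * Real.exp (-(α * n / 2 ^ 66))) := by
        rw [abs_mul, abs_of_nonneg ha0]
        exact (mul_le_of_le_one_right (abs_nonneg _) ha1).trans h1
      have h4 := abs_add_le (indepProb w n (k + 1) - indepProb w n k * a)
        ((indepProb w n k - ∏ i ∈ range k, (1 - ((Fintype.card F : ℝ) ^ (n - i))⁻¹)) * a)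
      rw [sub_mul, sub_add_sub_cancel] at h4
      push_cast
      rw [sub_mul] at h3
      linarith
  have h := key n le_rfl
  rw [← Finset.prod_range_reflect (fun i => 1 - ((Fintype.card F : ℝ) ^ (i + 1))⁻¹) n]
  have : ∏ j ∈ range n, (1 - ((Fintype.card F : ℝ) ^ (n - 1 - j + 1))⁻¹) =
      ∏ i ∈ range n, (1 - ((Fintype.card F : ℝ) ^ (n - i))⁻¹) := by
    refine Finset.prod_congr rfl fun i hi => ?_
    have := Finset.mem_range.1 hi
    rw [show n - 1 - i + 1 = n - i by omega]
  rw [this]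
  exact h

end

lemma abs_prod_sub_tprod_le {q : ℝ} (hq : 2 ≤ q) (n : ℕ) :
    |∏ i ∈ range n, (1 - (q ^ (i + 1))⁻¹) - ∏' i : ℕ, (1 - (q ^ (i + 1))⁻¹)| ≤ (2 ^ n)⁻¹ := by
  have hq0 : 0 < q := by linarith
  have hterm : ∀ i : ℕ, (q ^ (i + 1))⁻¹ ≤ (2 ^ (i + 1))⁻¹ := fun i => by gcongr
  have hpos : ∀ i : ℕ, 0 < (q ^ (i + 1))⁻¹ := fun i => by positivity
  have hle1 : ∀ i : ℕ, (q ^ (i + 1))⁻¹ ≤ 1 := fun i =>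
    inv_le_one_of_one_le₀ (one_le_pow₀ (by linarith))
  have hmul : Multipliable fun i : ℕ => 1 - (q ^ (i + 1))⁻¹ := by
    have h1 : Summable fun i : ℕ => ‖-(q ^ (i + 1))⁻¹‖ := by
      have h2 : Summable fun i : ℕ => (q⁻¹) ^ (i + 1) :=
        (summable_nat_add_iff 1).2 (summable_geometric_of_lt_one (by positivity)
          (inv_lt_one_of_one_lt₀ (by linarith)))
      refine h2.congr fun i => ?_
      rw [norm_neg, Real.norm_of_nonneg (hpos i).le, inv_pow]
    have h3 := multipliable_one_add_of_summable h1
    simpa only [← sub_eq_add_neg] using h3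
  have hb : ∀ N, 0 ≤ ∏ i ∈ range N, (1 - (q ^ (i + 1))⁻¹) ∧
      ∏ i ∈ range N, (1 - (q ^ (i + 1))⁻¹) ≤ 1 := fun N =>
    ⟨Finset.prod_nonneg fun i _ => by linarith [hle1 i],
      Finset.prod_le_one (fun i _ => by linarith [hle1 i]) fun i _ => by linarith [hpos i]⟩
  have hstep : ∀ N, |∏ i ∈ range n, (1 - (q ^ (i + 1))⁻¹) -
      ∏ i ∈ range (N + n), (1 - (q ^ (i + 1))⁻¹)| ≤ (2 ^ n)⁻¹ - (2 ^ (N + n))⁻¹ := by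
    intro N
    induction N with
    | zero => simp
    | succ N ih =>
      rw [show N + 1 + n = N + n + 1 by ring, Finset.prod_range_succ]
      have h1 := hb (N + n)
      set A := ∏ i ∈ range (N + n), (1 - (q ^ (i + 1))⁻¹)
      have h2 := hterm (N + n)
      have h3 : A * (q ^ (N + n + 1))⁻¹ ≤ (2 ^ (N + n + 1))⁻¹ :=
        (mul_le_of_le_one_left (hpos _).le h1.2).trans h2
      have h4 : 0 ≤ A * (q ^ (N + n + 1))⁻¹ := mul_nonneg h1.1 (hpos _).le
      have h5 : ((2 : ℝ) ^ (N + n))⁻¹ = 2 * (2 ^ (N + n + 1))⁻¹ := by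
        rw [pow_succ, mul_inv]; ring
      rw [abs_le] at ih ⊢
      constructor <;> nlinarith
  have hlim := (hmul.hasProd.tendsto_prod_nat.comp (Filter.tendsto_add_atTop_nat n))
  have hlim2 := (tendsto_const_nhds (x := ∏ i ∈ range n, (1 - (q ^ (i + 1))⁻¹))).sub hlim
  refine le_of_tendsto hlim2.abs (Filter.Eventually.of_forall fun N => ?_)
  have : (0 : ℝ) < (2 ^ (N + n))⁻¹ := by positivity
  have := hstep N
  simp only [Function.comp]
  linarith

/-! ### Random matrices -/

section

variable {F : Type*} [Field F] [Fintype F] [MeasurableSpace F] [DiscreteMeasurableSpace F]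
  {μ : Measure F} [IsProbabilityMeasure μ]

omit [Field F] in
lemma mass_measureReal (Q : F → Prop) : mass (fun x => μ.real {x}) Q = μ.real {x | Q x} := by
  rw [mass, ← Finset.sum_filter, sum_measureReal_singleton]
  simp

omit [Field F] in
lemma isWeight_measureReal : IsWeight (fun x => μ.real {x}) where
  nonneg _ := measureReal_nonneg
  sum_eq_one := by rw [sum_measureReal_singleton]; simp

lemma isDenseWeight_measureReal {α : ℝ} (h : IsAlphaDense α μ) :
    IsDenseWeight α fun x => μ.real {x} := by
  intro T hT s
  rw [mass_measureReal]
  refine le_trans (le_of_eq ?_) (h.2.2 T hT s)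
  congr 1
  ext x
  constructor
  · intro hx
    exact ⟨x - s, hx, by simp⟩
  · rintro ⟨t, ht, rfl⟩
    simpa using ht

omit [IsProbabilityMeasure μ] in
/-- A random matrix with independent entries of law `μ` is non-singular with the probability that
independent rows drawn from the product weight are linearly independent. -/
lemma measureReal_det_ne_zero {n : ℕ} {Ω : Type*} [MeasurableSpace Ω] {P : Measure Ω}
    [IsProbabilityMeasure P] {A : Ω → Matrix (Fin n) (Fin n) F}
    (hind : iIndepFun (fun (ij : Fin n × Fin n) ω => A ω ij.1 ij.2) P)
    (hlaw : ∀ i j : Fin n, HasLaw (fun ω => A ω i j) μ P) :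
    P.real {ω | (A ω).det ≠ 0} = indepProb (fun x => μ.real {x}) n n := by
  have hpt : ∀ M : Matrix (Fin n) (Fin n) F,
      P.real {ω | A ω = M} = prodWt (prodWt fun x => μ.real {x}) M := by
    intro M
    have h1 := hind.measure_inter_preimage_eq_mul univ (sets := fun ij => {M ij.1 ij.2})
      fun _ _ => measurableSet_singleton _
    have h2 : {ω | A ω = M} =
        ⋂ ij ∈ (univ : Finset (Fin n × Fin n)), (fun ω => A ω ij.1 ij.2) ⁻¹' {M ij.1 ij.2} := by
      ext ω
      simp only [Set.mem_iInter, Set.mem_preimage, Set.mem_singleton_iff, mem_univ, true_imp_iff,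
        Prod.forall]
      exact ⟨fun h i j => congrFun (congrFun h i) j, fun h => Matrix.ext h⟩
    rw [measureReal_def, h2, h1, ENNReal.toReal_prod, Fintype.prod_prod_type]
    unfold prodWt
    refine Finset.prod_congr rfl fun i _ => Finset.prod_congr rfl fun j _ => ?_
    change (P ((fun ω => A ω i j) ⁻¹' {M i j})).toReal = (μ {M i j}).toReal
    rw [← (hlaw i j).map_eq, Measure.map_apply_of_aemeasurable (hlaw i j).aemeasurable (measurableSet_singleton _)]
  have hmeas : ∀ M : Matrix (Fin n) (Fin n) F, NullMeasurableSet {ω | A ω = M} P := by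
    intro M
    have h2 : {ω | A ω = M} = ⋂ i, ⋂ j, (fun ω => A ω i j) ⁻¹' {M i j} := by
      ext ω
      simp only [Set.mem_iInter, Set.mem_preimage, Set.mem_singleton_iff]
      exact ⟨fun h i j => congrFun (congrFun h i) j, fun h => Matrix.ext h⟩
    rw [h2]
    exact NullMeasurableSet.iInter fun i => NullMeasurableSet.iInter fun j =>
      (hlaw i j).aemeasurable.nullMeasurable (measurableSet_singleton _)
  have hunion : {ω | (A ω).det ≠ 0} =
      ⋃ M ∈ univ.filter (fun M : Matrix (Fin n) (Fin n) F => M.det ≠ 0), {ω | A ω = M} := by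
    ext ω; simp
  rw [hunion, measureReal_def, measure_biUnion_finset₀ ?_ fun M _ => hmeas M,
    ENNReal.toReal_sum fun _ _ => measure_ne_top _ _, indepProb, mass, Finset.sum_filter]
  · refine Finset.sum_congr rfl fun M _ => ?_
    have h3 : M.det ≠ 0 ↔ LinearIndependent F (M : Fin n → Fin n → F) := by
      rw [← isUnit_iff_ne_zero, ← Matrix.isUnit_iff_isUnit_det,
        ← Matrix.linearIndependent_rows_iff_isUnit]
      rfl
    have h4 := hpt M
    rw [measureReal_def] at h4
    by_cases hM : M.det ≠ 0
    · rw [if_pos hM, if_pos (h3.1 hM), h4]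
    · rw [if_neg hM, if_neg fun h => hM (h3.2 h)]
  · intro M _ M' _ hne
    refine Disjoint.aedisjoint (Set.disjoint_left.2 fun ω h h' => hne ?_)
    exact (show A ω = M from h).symm.trans h'

lemma exists_addChar_ne_one (F : Type*) [Field F] [Finite F] : ∃ ψ : AddChar F ℂ, ψ ≠ 1 := by
  obtain ⟨ψ, hψ⟩ := AddChar.exists_apply_ne_zero.2 (one_ne_zero (α := F))
  exact ⟨ψ, fun h => hψ (by rw [h]; simp)⟩

end

end RandomMatrix

theorem mainTheorem1 :
    ∃ C K c : ℝ, 0 < C ∧ 0 < K ∧ 0 < c ∧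
      ∀ (F : Type*) [Field F] [Finite F] [MeasurableSpace F] [DiscreteMeasurableSpace F]
        (α : ℝ) (μ : MeasureTheory.Measure F) [MeasureTheory.IsProbabilityMeasure μ],
        IsAlphaDense α μ →
        ∀ n : ℕ, C * Real.log n ≤ α * n →
        ∀ (Ω : Type*) [MeasurableSpace Ω] (P : MeasureTheory.Measure Ω)
          [MeasureTheory.IsProbabilityMeasure P]
          (A : Ω → Matrix (Fin n) (Fin n) F),
          ProbabilityTheory.iIndepFun (fun (ij : Fin n × Fin n) ω => A ω ij.1 ij.2) P →
          (∀ i j : Fin n, ProbabilityTheory.HasLaw (fun ω => A ω i j) μ P) →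
          |P.real {ω | (A ω).det ≠ 0} - ∏' k : ℕ, (1 - ((Nat.card F : ℝ) ^ (k + 1))⁻¹)|
            ≤ K * Real.exp (-(c * α * n)) := by
  refine ⟨2 ^ 67, 16, (2 ^ 67)⁻¹, by positivity, by positivity, by positivity, ?_⟩
  intro F _ _ _ _ α μ _ hα n hC Ω _ P _ A hind hlaw
  have : Fintype F := Fintype.ofFinite F
  obtain ⟨ψ, hψ⟩ := RandomMatrix.exists_addChar_ne_one F
  have hα0 := hα.1
  have hα1 := hα.2.1
  rw [RandomMatrix.measureReal_det_ne_zero hind hlaw, Nat.card_eq_fintype_card]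
  set w : F → ℝ := fun x => μ.real {x}
  have hw : RandomMatrix.IsWeight w := RandomMatrix.isWeight_measureReal
  have hd : RandomMatrix.IsDenseWeight α w := RandomMatrix.isDenseWeight_measureReal hα
  have hq : (2 : ℝ) ≤ Fintype.card F := by exact_mod_cast Fintype.one_lt_card (α := F)
  have htail := RandomMatrix.abs_prod_sub_tprod_le hq n
  have htwo := RandomMatrix.two_pow_inv_le n
  have hn0 : (0 : ℝ) ≤ n := Nat.cast_nonneg n
  have hαn0 : 0 ≤ α * n := by positivity
  have hαn1 : α * n ≤ n := mul_le_of_le_one_left hn0 hα1.le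
  have hexp : (2 ^ 67 : ℝ)⁻¹ * α * n = α * n / 2 ^ 67 := by ring
  rw [hexp]
  set t := Real.exp (-(α * n / 2 ^ 67)) with ht
  have htwo' : ((2 : ℝ) ^ n)⁻¹ ≤ t := htwo.trans (by rw [ht, Real.exp_le_exp]; linarith)
  have hsplit := abs_add_le
    (RandomMatrix.indepProb w n n - ∏ i ∈ Finset.range n, (1 - ((Fintype.card F : ℝ) ^ (i + 1))⁻¹))
    (∏ i ∈ Finset.range n, (1 - ((Fintype.card F : ℝ) ^ (i + 1))⁻¹) -
      ∏' k : ℕ, (1 - ((Fintype.card F : ℝ) ^ (k + 1))⁻¹))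
  rw [sub_add_sub_cancel] at hsplit
  suffices h : |RandomMatrix.indepProb w n n -
      ∏ i ∈ Finset.range n, (1 - ((Fintype.card F : ℝ) ^ (i + 1))⁻¹)| ≤ 15 * t by linarith
  rcases Nat.lt_or_ge n 2 with hn | hn
  · -- for `n ≤ 1` the bound exceeds `1`
    have hn1 : (n : ℝ) ≤ 1 := by exact_mod_cast (by omega : n ≤ 1)
    have ht1 : 1 / 2 ≤ t := by
      have := Real.add_one_le_exp (-(α * n / 2 ^ 67))
      linarith
    have hle1 : ∀ i : ℕ, ((Fintype.card F : ℝ) ^ (i + 1))⁻¹ ≤ 1 := fun i =>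
      inv_le_one_of_one_le₀ (one_le_pow₀ (by linarith))
    have hpos : ∀ i : ℕ, 0 ≤ ((Fintype.card F : ℝ) ^ (i + 1))⁻¹ := fun i => by positivity
    refine (RandomMatrix.abs_sub_le_one_of_mem (hw.prodWt.prodWt.mass_nonneg _)
      (hw.prodWt.prodWt.mass_le_one _)
      (Finset.prod_nonneg fun i _ => by linarith [hle1 i])
      (Finset.prod_le_one (fun i _ => by linarith [hle1 i])
        fun i _ => by linarith [hpos i])).trans (by linarith)
  · have hn2 : (2 : ℝ) ≤ n := by exact_mod_cast hn
    have hlog2 : Real.log 2 ≤ Real.log n := Real.log_le_log (by norm_num) hn2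
    have hlog0 := Real.log_two_gt_d9
    refine (RandomMatrix.abs_indepProb_sub_prod_le hψ hw hd hα0 hα1 hn (by linarith)
      (by linarith)).trans ?_
    -- the factor `n` is absorbed by half of the exponent
    have h1 : (n : ℝ) * Real.exp (-(α * n / 2 ^ 66)) ≤ t := by
      rw [← Real.exp_log (by linarith : (0 : ℝ) < n), ← Real.exp_add, ht,
        Real.exp_log (by linarith), Real.exp_le_exp]
      linarith
    linarith
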